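/- Let $k$ be a field of characteristic $0$, let $n\ge 0$ be an integer, and let $A_n=k[x,y,z]/(xy-z^{n+1})$ be the coordinate ring of the Gorenstein toric surface $\mathrm{Spec}(A_n)$ given by $xy=z^{n+1}$. Let $\operatorname{HH}^{\bullet}(A_n)$ denote the Hochschild cohomology of the $k$-algebra $A_n$ with coefficients in $A_n$, that is, the cohomology of the complex of $k$-multilinear maps $A_n^{\,m}\to A_n$ ($m\ge 0$) with the Hochschild differential. The Gerstenhaber product $$[\cdot,\cdot]:\operatorname{HH}^2(A_n)\times \operatorname{HH}^2(A_n)\to \operatorname{HH}^3(A_n),$$ which is induced by the Gerstenhaber bracket of $2$-cochains $$[f,g](a,b,c)=f(g(a,b),c)-f(a,g(b,c))+g(f(a,b),c)-g(a,f(b,c)),$$ is the zero map. -/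

import Mathlib

namespace Hochschild

section Cochains

variable (k : Type*) [CommRing k] (A : Type*) [CommRing A] [Algebra k A]

/-- Hochschild `n`-cochains of the `k`-algebra `A` with values in `A`:
`k`-multilinear maps `Aⁿ → A`. -/
def Cochain (n : ℕ) : Type _ := MultilinearMap k (fun _ : Fin n => A) A

instance (n : ℕ) : AddCommGroup (Cochain k A n) :=
  inferInstanceAs (AddCommGroup (MultilinearMap k (fun _ : Fin n => A) A))

instance (n : ℕ) : Module k (Cochain k A n) :=
  inferInstanceAs (Module k (MultilinearMap k (fun _ : Fin n => A) A))

instance (n : ℕ) : FunLike (Cochain k A n) (Fin n → A) A :=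
  inferInstanceAs (FunLike (MultilinearMap k (fun _ : Fin n => A) A) (Fin n → A) A)

end Cochains

variable {k : Type*} [CommRing k] {A : Type*} [CommRing A] [Algebra k A]

namespace Cochain

/-- A cochain as a multilinear map. -/
def toMultilinear {n : ℕ} (f : Cochain k A n) : MultilinearMap k (fun _ : Fin n => A) A := f

/-- A function that is linear in every argument, as a cochain. -/
def mk {n : ℕ} (F : (Fin n → A) → A)
    (hadd : ∀ a i x y, F (Function.update a i (x + y)) =
      F (Function.update a i x) + F (Function.update a i y))
    (hsmul : ∀ a i (c : k) x, F (Function.update a i (c • x)) = c • F (Function.update a i x)) :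
    Cochain k A n :=
  MultilinearMap.mk' F hadd hsmul

@[simp] theorem mk_apply {n : ℕ} (F : (Fin n → A) → A)
    (hadd : ∀ a i x y, F (Function.update a i (x + y)) =
      F (Function.update a i x) + F (Function.update a i y))
    (hsmul : ∀ a i (c : k) x, F (Function.update a i (c • x)) = c • F (Function.update a i x))
    (a : Fin n → A) : mk F hadd hsmul a = F a := rfl

variable {n : ℕ}

@[ext] theorem ext {f g : Cochain k A n} (h : ∀ a, f a = g a) : f = g := DFunLike.ext f g h

@[simp] theorem add_apply (f g : Cochain k A n) (a : Fin n → A) : (f + g) a = f a + g a := rfl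

@[simp] theorem sub_apply (f g : Cochain k A n) (a : Fin n → A) : (f - g) a = f a - g a := rfl

@[simp] theorem neg_apply (f : Cochain k A n) (a : Fin n → A) : (-f) a = -f a := rfl

@[simp] theorem zero_apply (a : Fin n → A) : (0 : Cochain k A n) a = 0 := rfl

@[simp] theorem smul_apply (c : k) (f : Cochain k A n) (a : Fin n → A) : (c • f) a = c • f a := rfl

/-- Evaluation at a vector of arguments. -/
def eval (a : Fin n → A) : Cochain k A n →ₗ[k] A where
  toFun f := f a
  map_add' _ _ := rfl
  map_smul' _ _ := rfl

@[simp] theorem zsmul_apply (c : ℤ) (f : Cochain k A n) (a : Fin n → A) : (c • f) a = c • f a :=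
  map_zsmul (eval a) c f

@[simp] theorem sum_apply {ι : Type*} (s : Finset ι) (f : ι → Cochain k A n) (a : Fin n → A) :
    (∑ i ∈ s, f i) a = ∑ i ∈ s, f i a :=
  map_sum (eval a) f s

@[simp] theorem map_update_add (f : Cochain k A n) (a : Fin n → A) (i : Fin n) (x y : A) :
    f (Function.update a i (x + y)) = f (Function.update a i x) + f (Function.update a i y) :=
  MultilinearMap.map_update_add f.toMultilinear a i x y

@[simp] theorem map_update_smul (f : Cochain k A n) (a : Fin n → A) (i : Fin n) (c : k) (x : A) :
    f (Function.update a i (c • x)) = c • f (Function.update a i x) :=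
  MultilinearMap.map_update_smul f.toMultilinear a i c x

end Cochain

/-- Precompose a multilinear map with a map of argument vectors that turns a change of one
argument into a linear change of one argument. -/
def compArgs {p q : ℕ} (f : Cochain k A q) (φ : (Fin p → A) → (Fin q → A))
    (hφ : ∀ (a : Fin p → A) (i : Fin p), ∃ (j : Fin q) (L : A →ₗ[k] A),
      ∀ x, φ (Function.update a i x) = Function.update (φ a) j (L x)) : Cochain k A p :=
  Cochain.mk (fun a => f (φ a))
    (fun a i x y => by obtain ⟨j, L, h⟩ := hφ a i; simp only [h, map_add, f.map_update_add])
    (fun a i c x => by obtain ⟨j, L, h⟩ := hφ a i; simp only [h, map_smul, f.map_update_smul])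

/-! ### The Hochschild differential -/

/-- `(a₀, …, aₙ) ↦ a₀ f(a₁, …, aₙ)`. -/
def dFirst {n : ℕ} (f : Cochain k A n) : Cochain k A (n + 1) :=
  Cochain.mk (fun a => a 0 * f (Fin.tail a))
    (fun a i x y => by
      refine Fin.cases ?_ (fun i => ?_) i
      · simp [add_mul]
      · simp [mul_add, Function.update_of_ne (Fin.succ_ne_zero i).symm])
    (fun a i c x => by
      refine Fin.cases ?_ (fun i => ?_) i
      · simp
      · simp [Function.update_of_ne (Fin.succ_ne_zero i).symm])

/-- `(a₀, …, aₙ) ↦ f(a₀, …, aₙ₋₁) aₙ`. -/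
def dLast {n : ℕ} (f : Cochain k A n) : Cochain k A (n + 1) :=
  Cochain.mk (fun a => f (Fin.init a) * a (Fin.last n))
    (fun a i x y => by
      refine Fin.lastCases ?_ (fun i => ?_) i
      · simp [mul_add]
      · simp [add_mul, (Fin.castSucc_lt_last i).ne'])
    (fun a i c x => by
      refine Fin.lastCases ?_ (fun i => ?_) i
      · simp
      · simp [(Fin.castSucc_lt_last i).ne'])

theorem contractNth_update {n : ℕ} (i : Fin n) (a : Fin (n + 1) → A) (p : Fin (n + 1)) :
    ∃ (j : Fin n) (L : A →ₗ[k] A), ∀ x,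
      Fin.contractNth i.castSucc (· * ·) (Function.update a p x) =
        Function.update (Fin.contractNth i.castSucc (· * ·) a) j (L x) := by
  rcases lt_trichotomy p.val i.val with h | h | h
  · refine ⟨⟨p, by omega⟩, LinearMap.id, fun x => funext fun l => ?_⟩
    simp only [Fin.contractNth, Function.update_apply, Fin.ext_iff, Fin.val_castSucc, Fin.val_succ,
      LinearMap.id_apply]
    grind
  · refine ⟨i, LinearMap.mulRight k (a i.succ), fun x => funext fun l => ?_⟩
    simp only [Fin.contractNth, Function.update_apply, Fin.ext_iff, Fin.val_castSucc, Fin.val_succ,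
      LinearMap.mulRight_apply]
    have : l.val = i.val → l = i := Fin.ext
    grind
  · rcases Nat.lt_or_ge (i.val + 1) p.val with h' | h'
    · refine ⟨⟨p - 1, by omega⟩, LinearMap.id, fun x => funext fun l => ?_⟩
      simp only [Fin.contractNth, Function.update_apply, Fin.ext_iff, Fin.val_castSucc,
        Fin.val_succ, LinearMap.id_apply]
      grind
    · refine ⟨i, LinearMap.mulLeft k (a i.castSucc), fun x => funext fun l => ?_⟩
      simp only [Fin.contractNth, Function.update_apply, Fin.ext_iff, Fin.val_castSucc,
        Fin.val_succ, LinearMap.mulLeft_apply]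
      have : l.val = i.val → l = i := Fin.ext
      grind

/-- `(a₀, …, aₙ) ↦ f(a₀, …, aᵢ aᵢ₊₁, …, aₙ)`. -/
def dInner {n : ℕ} (i : Fin n) (f : Cochain k A n) : Cochain k A (n + 1) :=
  compArgs f (fun a => Fin.contractNth i.castSucc (· * ·) a) (contractNth_update i)

variable (k A) in
/-- The Hochschild differential `Cⁿ(A) → Cⁿ⁺¹(A)`,
`(df)(a₀, …, aₙ) = a₀ f(a₁, …, aₙ) + ∑ᵢ (-1)ⁱ⁺¹ f(a₀, …, aᵢ aᵢ₊₁, …, aₙ)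
  + (-1)ⁿ⁺¹ f(a₀, …, aₙ₋₁) aₙ`. -/
def d (n : ℕ) : Cochain k A n →ₗ[k] Cochain k A (n + 1) where
  toFun f := dFirst f + ∑ i : Fin n, (-1 : ℤ) ^ (i.val + 1) • dInner i f
    + (-1 : ℤ) ^ (n + 1) • dLast f
  map_add' f g := by
    ext a
    simp [dFirst, dLast, dInner, compArgs, mul_add, add_mul, Finset.sum_add_distrib]
    ring
  map_smul' c f := by
    ext a
    simp [dFirst, dLast, dInner, compArgs, Finset.smul_sum, smul_comm c]

/-! ### Hochschild cohomology -/

variable (k A) in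
/-- Hochschild `n`-cocycles. -/
def cocycles (n : ℕ) : Submodule k (Cochain k A n) := LinearMap.ker (d k A n)

variable (k A) in
/-- Hochschild `n`-coboundaries. -/
def coboundaries : (n : ℕ) → Submodule k (Cochain k A n)
  | 0 => ⊥
  | n + 1 => LinearMap.range (d k A n)

variable (k A) in
/-- The Hochschild cohomology `HHⁿ(A)`: cocycles modulo coboundaries. -/
abbrev HH (n : ℕ) : Type _ :=
  cocycles k A n ⧸ (coboundaries k A n).submoduleOf (cocycles k A n)

/-- The class in `HHⁿ(A)` of a cocycle. -/
def toHH (n : ℕ) : cocycles k A n →ₗ[k] HH k A n :=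
  ((coboundaries k A n).submoduleOf (cocycles k A n)).mkQ

/-! ### The Gerstenhaber bracket -/

/-- The vector `(a₀, …, aᵢ₋₁, g(aᵢ, …, aᵢ₊ₙ), aᵢ₊ₙ₊₁, …, aₘ₊ₙ)`. -/
def insertArgs {m n : ℕ} (g : Cochain k A (n + 1)) (i : Fin (m + 1))
    (a : Fin (m + n + 1) → A) : Fin (m + 1) → A := fun j =>
  if j < i then a ⟨j, by omega⟩
  else if j = i then g (fun l => a ⟨i + l, by omega⟩)
  else a ⟨j + n, by omega⟩

theorem insertArgs_update {m n : ℕ} (g : Cochain k A (n + 1)) (i : Fin (m + 1))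
    (a : Fin (m + n + 1) → A) (p : Fin (m + n + 1)) :
    ∃ (j : Fin (m + 1)) (L : A →ₗ[k] A), ∀ x,
      insertArgs g i (Function.update a p x) = Function.update (insertArgs g i a) j (L x) := by
  by_cases h : p.val < i.val
  · refine ⟨⟨p, by omega⟩, LinearMap.id, fun x => funext fun l => ?_⟩
    simp only [insertArgs, Function.update_apply, Fin.ext_iff, Fin.lt_def, LinearMap.id_apply]
    have : ∀ t : Fin (n + 1), ¬ (i.val + t.val = p.val) := by intro t; omega
    simp only [this, if_false]
    grind
  · by_cases h' : p.val ≤ i.val + n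
    · refine ⟨i, g.toMultilinear.toLinearMap (fun l => a ⟨i + l, by omega⟩) ⟨p - i, by omega⟩,
        fun x => funext fun l => ?_⟩
      have key : (fun l : Fin (n + 1) => Function.update a p x ⟨i + l, by omega⟩) =
          Function.update (fun l : Fin (n + 1) => a ⟨i + l, by omega⟩) ⟨p - i, by omega⟩ x := by
        funext t
        simp only [Function.update_apply, Fin.ext_iff]
        have : i.val + t.val = p.val ↔ t.val = p.val - i.val := by omega
        simp only [this]
      simp only [insertArgs, key]
      by_cases hl : l = i
      · subst hl
        simp
        rfl
      · rw [Function.update_of_ne hl]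
        have hl' : l.val ≠ i.val := fun e => hl (Fin.ext e)
        simp only [insertArgs, Function.update_apply, Fin.ext_iff, Fin.lt_def]
        grind
    · refine ⟨⟨p - n, by omega⟩, LinearMap.id, fun x => funext fun l => ?_⟩
      simp only [insertArgs, Function.update_apply, Fin.ext_iff, Fin.lt_def, LinearMap.id_apply]
      have : ∀ t : Fin (n + 1), ¬ (i.val + t.val = p.val) := by intro t; omega
      simp only [this, if_false]
      grind

/-- Insertion of `g` at the place `i` of `f`:
`(a₀, …, aₘ₊ₙ) ↦ f(a₀, …, aᵢ₋₁, g(aᵢ, …, aᵢ₊ₙ), aᵢ₊ₙ₊₁, …, aₘ₊ₙ)`. -/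
def insertion {m n : ℕ} (f : Cochain k A (m + 1)) (g : Cochain k A (n + 1)) (i : Fin (m + 1)) :
    Cochain k A (m + n + 1) :=
  compArgs f (insertArgs g i) (insertArgs_update g i)

/-- The Gerstenhaber (pre-Lie) product `f ∘ g = ∑ᵢ (-1)^(i n) f ∘ᵢ g` of
`f ∈ Cᵐ⁺¹(A)` and `g ∈ Cⁿ⁺¹(A)`. -/
def circ {m n : ℕ} (f : Cochain k A (m + 1)) (g : Cochain k A (n + 1)) :
    Cochain k A (m + n + 1) :=
  ∑ i : Fin (m + 1), (-1 : ℤ) ^ (i.val * n) • insertion f g i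

/-- Identify `Cᵖ(A)` with `C^q(A)` when `p = q`. -/
def reindex {p q : ℕ} (h : p = q) (f : Cochain k A p) : Cochain k A q :=
  f.toMultilinear.domDomCongr (finCongr h)

/-- The Gerstenhaber bracket `[f, g] = f ∘ g - (-1)^(m n) g ∘ f` of
`f ∈ Cᵐ⁺¹(A)` and `g ∈ Cⁿ⁺¹(A)`; it lies in `Cᵐ⁺ⁿ⁺¹(A)`. -/
def bracket {m n : ℕ} (f : Cochain k A (m + 1)) (g : Cochain k A (n + 1)) :
    Cochain k A (m + n + 1) :=
  circ f g - (-1 : ℤ) ^ (m * n) • reindex (by omega) (circ g f)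

/-! ### The Gerstenhaber product `HH²(A) × HH²(A) → HH³(A)`

The bracket of `2`-cochains is computed on arguments; it induces a product in cohomology because
the bracket of two cocycles is a cocycle, and a coboundary if one of them is a coboundary. -/

theorem eq_vec2 {A : Type*} (a : Fin 2 → A) : a = ![a 0, a 1] := by
  ext i; fin_cases i <;> rfl

theorem eq_vec3 {A : Type*} (a : Fin 3 → A) : a = ![a 0, a 1, a 2] := by
  ext i; fin_cases i <;> rfl

theorem eq_vec4 {A : Type*} (a : Fin 4 → A) : a = ![a 0, a 1, a 2, a 3] := by
  ext i; fin_cases i <;> rfl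

theorem apply_congr1 (f : Cochain k A 1) {v : Fin 1 → A} {x : A} (h0 : v 0 = x) :
    f v = f ![x] := by
  congr 1; ext i; fin_cases i; exact h0

theorem apply_congr2 (f : Cochain k A 2) {v : Fin 2 → A} {x y : A} (h0 : v 0 = x) (h1 : v 1 = y) :
    f v = f ![x, y] := by
  rw [eq_vec2 v, h0, h1]

theorem apply_congr3 (f : Cochain k A 3) {v : Fin 3 → A} {x y z : A} (h0 : v 0 = x)
    (h1 : v 1 = y) (h2 : v 2 = z) : f v = f ![x, y, z] := by
  rw [eq_vec3 v, h0, h1, h2]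

theorem d_one_apply (h : Cochain k A 1) (a b : A) :
    d k A 1 h ![a, b] = a * h ![b] - h ![a * b] + h ![a] * b := by
  have e1 : dFirst h ![a, b] = a * h ![b] :=
    congrArg (a * ·) (apply_congr1 h rfl)
  have e2 : dInner 0 h ![a, b] = h ![a * b] := apply_congr1 h rfl
  have e3 : dLast h ![a, b] = h ![a] * b := congrArg (· * b) (apply_congr1 h rfl)
  simp only [d, LinearMap.coe_mk, AddHom.coe_mk, Cochain.add_apply,
    Cochain.zsmul_apply, Fin.sum_univ_one, e1, e2, e3]
  simp
  ring

theorem d_two_apply (f : Cochain k A 2) (a b c : A) :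
    d k A 2 f ![a, b, c] = a * f ![b, c] - f ![a * b, c] + f ![a, b * c] - f ![a, b] * c := by
  have e1 : dFirst f ![a, b, c] = a * f ![b, c] :=
    congrArg (a * ·) (apply_congr2 f rfl rfl)
  have e2 : dInner 0 f ![a, b, c] = f ![a * b, c] := apply_congr2 f rfl rfl
  have e2' : dInner 1 f ![a, b, c] = f ![a, b * c] := apply_congr2 f rfl rfl
  have e3 : dLast f ![a, b, c] = f ![a, b] * c := congrArg (· * c) (apply_congr2 f rfl rfl)
  simp only [d, LinearMap.coe_mk, AddHom.coe_mk, Cochain.add_apply,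
    Cochain.zsmul_apply, Fin.sum_univ_two, e1, e2, e2', e3]
  simp
  ring

theorem d_three_apply (f : Cochain k A 3) (a b c e : A) :
    d k A 3 f ![a, b, c, e] = a * f ![b, c, e] - f ![a * b, c, e] + f ![a, b * c, e]
      - f ![a, b, c * e] + f ![a, b, c] * e := by
  have e1 : dFirst f ![a, b, c, e] = a * f ![b, c, e] :=
    congrArg (a * ·) (apply_congr3 f rfl rfl rfl)
  have e2 : dInner 0 f ![a, b, c, e] = f ![a * b, c, e] := apply_congr3 f rfl rfl rfl
  have e2' : dInner 1 f ![a, b, c, e] = f ![a, b * c, e] := apply_congr3 f rfl rfl rfl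
  have e2'' : dInner 2 f ![a, b, c, e] = f ![a, b, c * e] := apply_congr3 f rfl rfl rfl
  have e3 : dLast f ![a, b, c, e] = f ![a, b, c] * e :=
    congrArg (· * e) (apply_congr3 f rfl rfl rfl)
  simp only [d, LinearMap.coe_mk, AddHom.coe_mk, Cochain.add_apply,
    Cochain.zsmul_apply, Fin.sum_univ_three, e1, e2, e2', e2'', e3]
  simp
  ring

theorem bracket_two_two_apply (f g : Cochain k A 2) (a b c : A) :
    bracket (m := 1) (n := 1) f g ![a, b, c] =
      f ![g ![a, b], c] - f ![a, g ![b, c]] + (g ![f ![a, b], c] - g ![a, f ![b, c]]) := by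
  have key : ∀ f g : Cochain k A 2, circ (m := 1) (n := 1) f g ![a, b, c] =
      f ![g ![a, b], c] - f ![a, g ![b, c]] := by
    intro f g
    have e0 : insertion (m := 1) (n := 1) f g 0 ![a, b, c] = f ![g ![a, b], c] :=
      apply_congr2 f (apply_congr2 g rfl rfl) rfl
    have e1 : insertion (m := 1) (n := 1) f g 1 ![a, b, c] = f ![a, g ![b, c]] :=
      apply_congr2 f rfl (apply_congr2 g rfl rfl)
    unfold circ
    rw [Cochain.sum_apply]
    refine (Fin.sum_univ_two (M := A) _).trans ?_
    refine (congrArg₂ (fun u v : A => (-1 : ℤ) ^ (0 * 1) • u + (-1 : ℤ) ^ (1 * 1) • v)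
      e0 e1).trans ?_
    simp
    ring
  have key' : reindex (p := 3) (q := 3) rfl (circ (m := 1) (n := 1) g f) ![a, b, c] =
      g ![f ![a, b], c] - g ![a, f ![b, c]] :=
    (apply_congr3 (circ (m := 1) (n := 1) g f) rfl rfl rfl).trans (key g f)
  unfold bracket
  rw [Cochain.sub_apply, Cochain.zsmul_apply, key f g, key']
  simp
  ring

theorem bracket_two_one_apply (f : Cochain k A 2) (h : Cochain k A 1) (a b : A) :
    bracket (m := 1) (n := 0) f h ![a, b] =
      f ![h ![a], b] + f ![a, h ![b]] - h ![f ![a, b]] := by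
  have e0 : insertion (m := 1) (n := 0) f h 0 ![a, b] = f ![h ![a], b] :=
    apply_congr2 f (apply_congr1 h rfl) rfl
  have e1 : insertion (m := 1) (n := 0) f h 1 ![a, b] = f ![a, h ![b]] :=
    apply_congr2 f rfl (apply_congr1 h rfl)
  have key : circ (m := 1) (n := 0) f h ![a, b] = f ![h ![a], b] + f ![a, h ![b]] := by
    unfold circ
    rw [Cochain.sum_apply]
    refine (Fin.sum_univ_two (M := A) _).trans ?_
    refine (congrArg₂ (fun u v : A => (-1 : ℤ) ^ (0 * 0) • u + (-1 : ℤ) ^ (1 * 0) • v)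
      e0 e1).trans ?_
    simp
  have e2 : insertion (m := 0) (n := 1) h f 0 ![a, b] = h ![f ![a, b]] :=
    apply_congr1 h (apply_congr2 f rfl rfl)
  have key2 : circ (m := 0) (n := 1) h f ![a, b] = h ![f ![a, b]] := by
    unfold circ
    rw [Cochain.sum_apply]
    refine (Fin.sum_univ_one (M := A) _).trans ?_
    refine (congrArg (fun u : A => (-1 : ℤ) ^ (0 * 1) • u) e2).trans ?_
    simp
  have key' : reindex (p := 2) (q := 2) rfl (circ (m := 0) (n := 1) h f) ![a, b] =
      h ![f ![a, b]] :=
    (apply_congr2 (circ (m := 0) (n := 1) h f) rfl rfl).trans key2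
  unfold bracket
  rw [Cochain.sub_apply, Cochain.zsmul_apply, key, key']
  simp

theorem one_add (h : Cochain k A 1) (x y : A) : h ![x + y] = h ![x] + h ![y] := by
  have e : ∀ t, h (Function.update ![0] 0 t) = h ![t] := fun t =>
    apply_congr1 h rfl
  simpa only [e] using h.map_update_add ![0] 0 x y

theorem one_sub (h : Cochain k A 1) (x y : A) : h ![x - y] = h ![x] - h ![y] := by
  rw [eq_sub_iff_add_eq, ← one_add, sub_add_cancel]

theorem two_add_left (f : Cochain k A 2) (x y b : A) :
    f ![x + y, b] = f ![x, b] + f ![y, b] := by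
  have e : ∀ t, f (Function.update ![0, b] 0 t) = f ![t, b] := fun t =>
    apply_congr2 f rfl rfl
  simpa only [e] using f.map_update_add ![0, b] 0 x y

theorem two_add_right (f : Cochain k A 2) (a x y : A) :
    f ![a, x + y] = f ![a, x] + f ![a, y] := by
  have e : ∀ t, f (Function.update ![a, 0] 1 t) = f ![a, t] := fun t =>
    apply_congr2 f rfl rfl
  simpa only [e] using f.map_update_add ![a, 0] 1 x y

theorem two_sub_left (f : Cochain k A 2) (x y b : A) :
    f ![x - y, b] = f ![x, b] - f ![y, b] := by
  rw [eq_sub_iff_add_eq, ← two_add_left, sub_add_cancel]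

theorem two_sub_right (f : Cochain k A 2) (a x y : A) :
    f ![a, x - y] = f ![a, x] - f ![a, y] := by
  rw [eq_sub_iff_add_eq, ← two_add_right, sub_add_cancel]

theorem two_smul_left (f : Cochain k A 2) (c : k) (x b : A) :
    f ![c • x, b] = c • f ![x, b] := by
  have e : ∀ t, f (Function.update ![0, b] 0 t) = f ![t, b] := fun t =>
    apply_congr2 f rfl rfl
  simpa only [e] using f.map_update_smul ![0, b] 0 c x

theorem two_smul_right (f : Cochain k A 2) (a : A) (c : k) (x : A) :
    f ![a, c • x] = c • f ![a, x] := by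
  have e : ∀ t, f (Function.update ![a, 0] 1 t) = f ![a, t] := fun t =>
    apply_congr2 f rfl rfl
  simpa only [e] using f.map_update_smul ![a, 0] 1 c x

theorem cocycle_two {f : Cochain k A 2} (hf : f ∈ cocycles k A 2) (a b c : A) :
    a * f ![b, c] - f ![a * b, c] + f ![a, b * c] - f ![a, b] * c = 0 := by
  rw [← d_two_apply, show d k A 2 f = 0 from hf]
  rfl

theorem bracket_comm (f g : Cochain k A 2) :
    bracket (m := 1) (n := 1) f g = bracket (m := 1) (n := 1) g f := by
  ext a
  rw [eq_vec3 a]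
  exact (bracket_two_two_apply f g _ _ _).trans
    ((add_comm _ _).trans (bracket_two_two_apply g f _ _ _).symm)

variable (k A) in
/-- The Gerstenhaber bracket `C²(A) × C²(A) → C³(A)` as a bilinear map. -/
def bracketTwo : Cochain k A 2 →ₗ[k] Cochain k A 2 →ₗ[k] Cochain k A 3 :=
  LinearMap.mk₂ k (fun f g => bracket (m := 1) (n := 1) f g)
    (fun f f' g => by
      ext a
      rw [eq_vec3 a, Cochain.add_apply]
      simp only [bracket_two_two_apply, Cochain.add_apply, two_add_left, two_add_right]
      ring)
    (fun c f g => by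
      ext a
      rw [eq_vec3 a, Cochain.smul_apply]
      simp only [bracket_two_two_apply, Cochain.smul_apply, two_smul_left, two_smul_right,
        smul_sub, smul_add])
    (fun f g g' => by
      ext a
      rw [eq_vec3 a, Cochain.add_apply]
      simp only [bracket_two_two_apply, Cochain.add_apply, two_add_left, two_add_right]
      ring)
    (fun c f g => by
      ext a
      rw [eq_vec3 a, Cochain.smul_apply]
      simp only [bracket_two_two_apply, Cochain.smul_apply, two_smul_left, two_smul_right,
        smul_sub, smul_add])

theorem bracketTwo_apply (f g : Cochain k A 2) (a b c : A) :
    bracketTwo k A f g ![a, b, c] =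
      f ![g ![a, b], c] - f ![a, g ![b, c]] + (g ![f ![a, b], c] - g ![a, f ![b, c]]) :=
  bracket_two_two_apply f g a b c

theorem bracketTwo_mem_cocycles {f g : Cochain k A 2} (hf : f ∈ cocycles k A 2)
    (hg : g ∈ cocycles k A 2) : bracketTwo k A f g ∈ cocycles k A 3 := by
  have key : ∀ f g : Cochain k A 2, f ∈ cocycles k A 2 → g ∈ cocycles k A 2 → ∀ a b c e : A,
      a * (f ![g ![b, c], e] - f ![b, g ![c, e]]) - (f ![g ![a * b, c], e] - f ![a * b, g ![c, e]])
      + (f ![g ![a, b * c], e] - f ![a, g ![b * c, e]])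
      - (f ![g ![a, b], c * e] - f ![a, g ![b, c * e]])
      + (f ![g ![a, b], c] - f ![a, g ![b, c]]) * e
      = g ![a, b] * f ![c, e] - f ![a, b] * g ![c, e] := by
    intro f g hf hg a b c e
    have h1 := cocycle_two hf (g ![a, b]) c e
    have h2 := cocycle_two hf a (g ![b, c]) e
    have h3 := cocycle_two hf a b (g ![c, e])
    have h4 : f ![a * g ![b, c], e] - f ![g ![a * b, c], e] + f ![g ![a, b * c], e]
        - f ![g ![a, b] * c, e] = 0 := by
      rw [← two_sub_left, ← two_add_left, ← two_sub_left, cocycle_two hg]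
      simpa using two_sub_left f 0 0 e
    have h5 : f ![a, b * g ![c, e]] - f ![a, g ![b * c, e]] + f ![a, g ![b, c * e]]
        - f ![a, g ![b, c] * e] = 0 := by
      rw [← two_sub_right, ← two_add_right, ← two_sub_right, cocycle_two hg]
      simpa using two_sub_right f a 0 0
    linear_combination h2 - h1 - h3 + h4 + h5
  change d k A 3 _ = 0
  ext a
  rw [eq_vec4 a, d_three_apply]
  simp only [bracketTwo_apply, Cochain.zero_apply]
  linear_combination key f g hf hg (a 0) (a 1) (a 2) (a 3) + key g f hg hf (a 0) (a 1) (a 2) (a 3)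

theorem bracketTwo_coboundary {f : Cochain k A 2} (hf : f ∈ cocycles k A 2) (h : Cochain k A 1) :
    bracketTwo k A f (d k A 1 h) = d k A 2 (bracket (m := 1) (n := 0) f h) := by
  ext v
  rw [eq_vec3 v]
  generalize v 0 = a, v 1 = b, v 2 = c
  rw [bracketTwo_apply, d_two_apply]
  simp only [bracket_two_one_apply, d_one_apply, two_add_left, two_add_right, two_sub_left,
    two_sub_right]
  have h1 := cocycle_two hf (h ![a]) b c
  have h2 := cocycle_two hf a (h ![b]) c
  have h3 := cocycle_two hf a b (h ![c])
  have h4 : h ![a * f ![b, c]] - h ![f ![a * b, c]] + h ![f ![a, b * c]] - h ![f ![a, b] * c]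
      = 0 := by
    rw [← one_sub, ← one_add, ← one_sub, cocycle_two hf]
    simpa using one_sub h 0 0
  linear_combination h4 - h1 - h2 - h3

theorem bracketTwo_mem_coboundaries {f g : Cochain k A 2} (hf : f ∈ cocycles k A 2)
    (hg : g ∈ coboundaries k A 2) : bracketTwo k A f g ∈ coboundaries k A 3 := by
  obtain ⟨h, rfl⟩ := hg
  rw [bracketTwo_coboundary hf]
  exact ⟨_, rfl⟩

variable (k A) in
/-- The bracket of two `2`-cocycles as a class in `HH³(A)`. -/
def cocycleProduct : cocycles k A 2 →ₗ[k] cocycles k A 2 →ₗ[k] HH k A 3 :=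
  LinearMap.mk₂ k
    (fun f g => toHH 3 ⟨bracketTwo k A f g, bracketTwo_mem_cocycles f.2 g.2⟩)
    (fun f f' g => by
      rw [← map_add]; congr 1; ext1; simp)
    (fun c f g => by
      rw [← map_smul]; congr 1; ext1; simp)
    (fun f g g' => by
      rw [← map_add]; congr 1; ext1; simp)
    (fun c f g => by
      rw [← map_smul]; congr 1; ext1; simp)

theorem toHH_eq_zero_iff {n : ℕ} (f : cocycles k A n) :
    toHH n f = 0 ↔ (f : Cochain k A n) ∈ coboundaries k A n :=
  Submodule.Quotient.mk_eq_zero _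

variable (k A) in
/-- The Gerstenhaber product `HH²(A) × HH²(A) → HH³(A)`, `([f], [g]) ↦ [[f, g]]`. -/
def gerstenhaberProduct : HH k A 2 →ₗ[k] HH k A 2 →ₗ[k] HH k A 3 :=
  Submodule.liftQ _
    (LinearMap.flip (Submodule.liftQ _ (LinearMap.flip (cocycleProduct k A)) (by
      intro g hg
      ext f
      exact (toHH_eq_zero_iff _).2 (bracketTwo_mem_coboundaries f.2 hg))))
    (by
      intro f hf
      ext g
      refine (toHH_eq_zero_iff _).2 ?_
      change bracket (m := 1) (n := 1) f.1 g.1 ∈ coboundaries k A 3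
      rw [bracket_comm]
      exact bracketTwo_mem_coboundaries g.2 hf)

/-- The Gerstenhaber product of the classes of two cocycles is the class of their bracket. -/
theorem gerstenhaberProduct_toHH (f g : cocycles k A 2) :
    gerstenhaberProduct k A (toHH 2 f) (toHH 2 g) =
      toHH 3 ⟨bracket (m := 1) (n := 1) f.1 g.1, bracketTwo_mem_cocycles f.2 g.2⟩ := rfl

end Hochschild

/-- The coordinate ring `Aₙ = k[x, y, z] / (x y - zⁿ⁺¹)` of the Gorenstein toric surface
`x y = zⁿ⁺¹`. -/
abbrev GorensteinSurfaceRing (k : Type*) [Field k] (n : ℕ) : Type _ :=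
  MvPolynomial (Fin 3) k ⧸ Ideal.span
    {(MvPolynomial.X 0 * MvPolynomial.X 1 - MvPolynomial.X 2 ^ (n + 1) : MvPolynomial (Fin 3) k)}

/-! Write `R = k[x, y, z]`, `F = xy - zⁿ⁺¹` and `A = R/(F)`. The bracket on `HH²` is symmetric and 2
is invertible, so by polarization it suffices that every class has bracket zero with itself. As `[f,
f]` is twice `f(f(a, b), c) - f(a, f(b, c))`, this holds once some cocycle `f` in the class, viewed
as a first-order deformation of `A`, extends to an associative product modulo `t³`.

Up to a coboundary, a 2-cocycle is given by two polynomials (`exists_normal_form_of_hypersurface`):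
`α`, which gives the Poisson bracket `α det(∇F, ∇a, ∇b)`, and `p`, which perturbs the equation to `F
+ tp`. The skew part of the cocycle is a biderivation; its coefficient vector has zero cross product
with `∇F`, hence is a multiple of `∇F` by Koszul exactness (`surface_koszul`). The symmetric part
becomes a coboundary on `R` because `R` is a free commutative algebra
(`exists_primitive_of_symmetric`), and `p` measures the failure of the primitive to descend to `A`.

Both deformations extend together. The bivector field `α∇F` has zero Schouten square, so it has a
star product modulo `t³` on `R` with symmetric second-order term (`exists_symmetric_second_order`).
Adding the bracket of `α∇p` in degree `t²` replaces `α∇F` by `α∇(F + tp)`, which makes `F + tp`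
central; dividing by it gives the extension on `A` (`exists_second_order_of_quotient`). -/

open MvPolynomial

/-! ### Second-order deformations of a quotient by a central element -/

section QuotientDeformation

variable {k R A : Type*} [CommRing k] [CommRing R] [Algebra k R] [CommRing A] [Algebra k A]

/-- The product on `R[t]/(t³)` with coefficients the given product of `R`, `m₁` and `m₂`. -/
def starMul (m₁ m₂ : R →ₗ[k] R →ₗ[k] R) (u v : R × R × R) : R × R × R :=
  (u.1 * v.1, u.1 * v.2.1 + u.2.1 * v.1 + m₁ u.1 v.1,
    u.1 * v.2.2 + u.2.1 * v.2.1 + u.2.2 * v.1 + m₁ u.1 v.2.1 + m₁ u.2.1 v.1 + m₂ u.1 v.1)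

/-- The coefficient of `t` is the cocycle identity for `m₁`. The coefficient of `t²` is `h₂` in the
constant terms, plus the cocycle identity with one argument taken from degree one. -/
theorem starMul_assoc {m₁ m₂ : R →ₗ[k] R →ₗ[k] R}
    (h₁ : ∀ a b c, a * m₁ b c - m₁ (a * b) c + m₁ a (b * c) - m₁ a b * c = 0)
    (h₂ : ∀ a b c, m₁ (m₁ a b) c - m₁ a (m₁ b c) =
      a * m₂ b c - m₂ (a * b) c + m₂ a (b * c) - m₂ a b * c)
    (u v w : R × R × R) :
    starMul m₁ m₂ (starMul m₁ m₂ u v) w = starMul m₁ m₂ u (starMul m₁ m₂ v w) := by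
  obtain ⟨u0, u1, u2⟩ := u
  obtain ⟨v0, v1, v2⟩ := v
  obtain ⟨w0, w1, w2⟩ := w
  simp only [starMul, Prod.mk.injEq, map_add, LinearMap.add_apply]
  refine ⟨by ring, by linear_combination -h₁ u0 v0 w0, ?_⟩
  linear_combination h₂ u0 v0 w0 - h₁ u0 v0 w1 - h₁ u0 v1 w0 - h₁ u1 v0 w0

theorem starMul_sub (m₁ m₂ : R →ₗ[k] R →ₗ[k] R) (u v w : R × R × R) :
    starMul m₁ m₂ u (v - w) = starMul m₁ m₂ u v - starMul m₁ m₂ u w := by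
  simp only [starMul, Prod.fst_sub, Prod.snd_sub, map_sub, Prod.mk_sub_mk, Prod.mk.injEq]
  exact ⟨by ring, by ring, by ring⟩

theorem sub_starMul (m₁ m₂ : R →ₗ[k] R →ₗ[k] R) (u v w : R × R × R) :
    starMul m₁ m₂ (u - v) w = starMul m₁ m₂ u w - starMul m₁ m₂ v w := by
  simp only [starMul, Prod.fst_sub, Prod.snd_sub, map_sub, Prod.mk_sub_mk, Prod.mk.injEq,
    LinearMap.sub_apply]
  exact ⟨by ring, by ring, by ring⟩

/-- Coefficients of `R[t]/(t³) → A[t]/(t³)`, the quotient by the central element `F + t p`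
identified with `A[t]/(t³)` through a section of `R → A` with remainder operator `q`. -/
def starReduce (pr : R →ₐ[k] A) (q : R →ₗ[k] R) (F p : R) (m₁ m₂ : R →ₗ[k] R →ₗ[k] R)
    (u : R × R × R) : A × A × A :=
  (pr u.1, pr u.2.1 - pr (p * q u.1), pr u.2.2 - pr (p * q u.2.1) +
    (pr (p * q (p * q u.1)) - pr (m₂ F (q u.1) + m₁ p (q u.1))))

theorem starReduce_sub (pr : R →ₐ[k] A) (q : R →ₗ[k] R) (F p : R) (m₁ m₂ : R →ₗ[k] R →ₗ[k] R)
    (u v : R × R × R) : starReduce pr q F p m₁ m₂ (u - v) =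
      starReduce pr q F p m₁ m₂ u - starReduce pr q F p m₁ m₂ v := by
  simp only [starReduce, Prod.fst_sub, Prod.snd_sub, map_sub, Prod.mk_sub_mk, Prod.mk.injEq,
    map_mul, map_add, mul_sub]
  exact ⟨trivial, by ring, by ring⟩

/-- If `m₁`, `m₂` define an associative product on `R[t]/(t³)` in which `F + t p` is central, then
the induced infinitesimal deformation of `A = R/(F)` extends to second order. -/
theorem exists_second_order_of_quotient (pr : R →ₐ[k] A) (s : A →ₗ[k] R) (q : R →ₗ[k] R) (F p : R)
    (hs : ∀ a, pr (s a) = a) (hF : pr F = 0) (hq : ∀ r, r = s (pr r) + F * q r)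
    (hqF : ∀ r, q (F * r) = r) (m₁ m₂ : R →ₗ[k] R →ₗ[k] R)
    (h₁ : ∀ a b c, a * m₁ b c - m₁ (a * b) c + m₁ a (b * c) - m₁ a b * c = 0)
    (h₂ : ∀ a b c, m₁ (m₁ a b) c - m₁ a (m₁ b c) =
      a * m₂ b c - m₂ (a * b) c + m₂ a (b * c) - m₂ a b * c)
    (hm : ∀ r, m₁ F r = 0) (hm' : ∀ r, m₁ r F = 0)
    (hc : ∀ r, m₂ F r + m₁ p r = m₂ r F + m₁ r p)
    (f : A → A → A) (hf : ∀ a b, f a b = pr (m₁ (s a) (s b)) - pr (p * q (s a * s b))) :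
    ∃ g : A →ₗ[k] A →ₗ[k] A, ∀ a b c, f (f a b) c - f a (f b c) =
      a * g b c - g (a * b) c + g a (b * c) - g a b * c := by
  -- This is the `t²`-coefficient of the reduction of `s a ⋆ s b` modulo `F + tp`; `f` is the
  -- `t`-coefficient.
  let g : A →ₗ[k] A →ₗ[k] A := LinearMap.mk₂ k
    (fun a b => pr (m₂ (s a) (s b)) - pr (p * q (m₁ (s a) (s b))) +
      (pr (p * q (p * q (s a * s b))) - pr (m₂ F (q (s a * s b)) + m₁ p (q (s a * s b)))))
    (fun a a' b => by
      simp only [map_add, LinearMap.add_apply, add_mul, mul_add]; ring)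
    (fun c a b => by
      simp only [map_smul, LinearMap.smul_apply, smul_mul_assoc, mul_smul_comm, smul_add, smul_sub,
        map_add])
    (fun a b b' => by
      simp only [map_add, mul_add]; ring)
    (fun c a b => by
      simp only [map_smul, mul_smul_comm, smul_add, smul_sub, map_add])
  let ρ := starReduce pr q F p m₁ m₂
  let σ : A × A × A → R × R × R := fun u => (s u.1, s u.2.1, s u.2.2)
  let μ := starMul m₁ m₂
  let G : R × R × R := (F, p, 0)
  have hρG (u) : ρ (μ G u) = 0 := by
    simp only [ρ, μ, G, starReduce, starMul, hm, map_add, map_mul, hF, hqF, zero_mul, mul_add,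
      map_zero]
    ext <;> simp
    ring
  have hG (u) : μ G u = μ u G := by
    simp only [μ, G, starMul, hm, hm', Prod.mk.injEq]
    exact ⟨by ring, by ring, by linear_combination hc u.1⟩
  -- Division with remainder by the element `G = F + tp`, one power of `t` at a time: each
  -- coefficient of the quotient is `q` of what the lower ones leave over.
  have hσρ (u) : ∃ w, u - σ (ρ u) = μ G w := by
    obtain ⟨u0, u1, u2⟩ := u
    refine ⟨(q u0, q u1 - q (p * q u0), q u2 + q (p * q (p * q u0)) -
      q (m₂ F (q u0) + m₁ p (q u0)) - q (p * q u1)), ?_⟩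
    simp only [σ, ρ, μ, G, starReduce, starMul, Prod.mk_sub_mk, Prod.mk.injEq, hm, map_sub s,
      map_add s]
    refine ⟨by linear_combination hq u0, ?_, ?_⟩
    · linear_combination hq u1 - hq (p * q u0)
    · linear_combination hq u2 + hq (p * q (p * q u0)) - hq (m₂ F (q u0) + m₁ p (q u0))
        - hq (p * q u1)
  -- Replacing a factor by its normal form changes the product by a multiple of `G`, which `ρ`
  -- kills. For the right factor, centrality first moves `G` to the left.
  have hl (u v) : ρ (μ (σ (ρ u)) v) = ρ (μ u v) := by
    obtain ⟨w, hw⟩ := hσρ u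
    rw [← sub_eq_zero, ← neg_eq_zero, neg_sub, ← starReduce_sub, ← sub_starMul, hw,
      starMul_assoc h₁ h₂]
    exact hρG _
  have hr (u v) : ρ (μ u (σ (ρ v))) = ρ (μ u v) := by
    obtain ⟨w, hw⟩ := hσρ v
    rw [← sub_eq_zero, ← neg_eq_zero, neg_sub, ← starReduce_sub, ← starMul_sub, hw, hG,
      ← starMul_assoc h₁ h₂]
    exact (congrArg ρ (hG _).symm).trans (hρG _)
  have hval (a b : A) : ρ (μ (σ (a, 0, 0)) (σ (b, 0, 0))) = (a * b, f a b, g a b) := by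
    simp [ρ, μ, σ, starReduce, starMul, hs, hf, g]
  refine ⟨g, fun a b c => ?_⟩
  -- Associativity of the reduced product on constants; its `t²`-coefficient is the claim.
  have key : ρ (μ (σ (a * b, f a b, g a b)) (σ (c, 0, 0))) =
      ρ (μ (σ (a, 0, 0)) (σ (b * c, f b c, g b c))) := by
    rw [← hval, ← hval, hl, hr]
    exact congrArg ρ (starMul_assoc h₁ h₂ _ _ _)
  have key2 := congrArg (fun u => u.2.2) key
  simp only [ρ, μ, σ, starReduce, starMul, map_zero, mul_zero, zero_mul, add_zero, zero_add,
    LinearMap.zero_apply, map_add, map_mul pr, hs] at key2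
  have e3 := hf (f a b) c
  have e4 := hf a (f b c)
  simp only [map_mul pr] at e3 e4
  have e1 : g (a * b) c = pr (m₂ (s (a * b)) (s c)) - pr p * pr (q (m₁ (s (a * b)) (s c))) +
      (pr p * pr (q (p * q (s (a * b) * s c))) - (pr (m₂ F (q (s (a * b) * s c))) +
        pr (m₁ p (q (s (a * b) * s c))))) := by
    simp [g]
  have e2 : g a (b * c) = pr (m₂ (s a) (s (b * c))) - pr p * pr (q (m₁ (s a) (s (b * c)))) +
      (pr p * pr (q (p * q (s a * s (b * c)))) - (pr (m₂ F (q (s a * s (b * c)))) +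
        pr (m₁ p (q (s a * s (b * c)))))) := by
    simp [g]
  linear_combination key2 + e3 - e4 + e1 - e2

end QuotientDeformation

/-! ### Star products modulo `t³` on affine three-space -/

section Star

variable {k : Type*} [Field k]

/-- The bidifferential operator `a, b ↦ c · D a · E b`. -/
def bidifferential {R : Type*} [CommRing R] [Algebra k R] (c : R) (D E : R →ₗ[k] R) :
    R →ₗ[k] R →ₗ[k] R :=
  LinearMap.mk₂ k (fun a b => c * D a * E b)
    (fun a a' b => by rw [map_add]; ring) (fun t a b => by simp)
    (fun a b b' => by rw [map_add]; ring) (fun t a b => by simp)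

@[simp] theorem bidifferential_apply {R : Type*} [CommRing R] [Algebra k R] (c : R)
    (D E : R →ₗ[k] R) (a b : R) : bidifferential c D E a b = c * D a * E b := rfl

/-- The components `uₗ = π^{ij}` (`(i, j, l)` cyclic) of a bivector field as a matrix. -/
def bivectorMatrix {R : Type*} [CommRing R] (u : Fin 3 → R) : Fin 3 → Fin 3 → R :=
  ![![0, u 2, -u 1], ![-u 2, 0, u 0], ![u 1, -u 0, 0]]

/-- The biderivation of `k[x₀, x₁, x₂]` given by a bivector field. -/
noncomputable def bivectorBracket (u : Fin 3 → MvPolynomial (Fin 3) k) :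
    MvPolynomial (Fin 3) k →ₗ[k] MvPolynomial (Fin 3) k →ₗ[k] MvPolynomial (Fin 3) k :=
  ∑ i, ∑ j, bidifferential (bivectorMatrix u i j) (pderiv i).toLinearMap (pderiv j).toLinearMap

theorem bivectorBracket_apply (u : Fin 3 → MvPolynomial (Fin 3) k) (a b : MvPolynomial (Fin 3) k) :
    bivectorBracket u a b = u 0 * (pderiv 1 a * pderiv 2 b - pderiv 2 a * pderiv 1 b)
      + u 1 * (pderiv 2 a * pderiv 0 b - pderiv 0 a * pderiv 2 b)
      + u 2 * (pderiv 0 a * pderiv 1 b - pderiv 1 a * pderiv 0 b) := by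
  simp [bivectorBracket, bivectorMatrix, Fin.sum_univ_three]
  ring

theorem pderiv_comm (i j : Fin 3) (a : MvPolynomial (Fin 3) k) :
    pderiv i (pderiv j a) = pderiv j (pderiv i a) := by
  have h : ⁅pderiv (R := k) i, pderiv (R := k) j⁆ = 0 := by
    refine derivation_ext fun l => ?_
    simp only [Derivation.commutator_apply, pderiv_X, Pi.single_apply]
    split_ifs <;> simp
  exact sub_eq_zero.1 (congrArg (fun D => D a) h)

/-- The Hamiltonian derivation of the coordinate `xᵢ`. -/
noncomputable def coordinateField (u : Fin 3 → MvPolynomial (Fin 3) k) (i : Fin 3) :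
    MvPolynomial (Fin 3) k →ₗ[k] MvPolynomial (Fin 3) k :=
  bivectorBracket u (X i)

theorem coordinateField_apply (u : Fin 3 → MvPolynomial (Fin 3) k) (i : Fin 3)
    (a : MvPolynomial (Fin 3) k) :
    coordinateField u i a = ∑ j, bivectorMatrix u i j * pderiv j a := by
  fin_cases i <;>
    simp [coordinateField, bivectorBracket_apply, bivectorMatrix, Fin.sum_univ_three, pderiv_X] <;>
    ring

theorem coordinateField_mul (u : Fin 3 → MvPolynomial (Fin 3) k) (i : Fin 3)
    (a b : MvPolynomial (Fin 3) k) :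
    coordinateField u i (a * b) = a * coordinateField u i b + b * coordinateField u i a := by
  simp only [coordinateField_apply, Derivation.leibniz, smul_eq_mul, Finset.mul_sum,
    ← Finset.sum_add_distrib]
  exact Finset.sum_congr rfl fun j _ => by ring

theorem bivectorBracket_eq_sum (u : Fin 3 → MvPolynomial (Fin 3) k)
    (a b : MvPolynomial (Fin 3) k) :
    bivectorBracket u a b = ∑ i, pderiv i a * coordinateField u i b := by
  simp [bivectorBracket_apply, coordinateField_apply, bivectorMatrix, Fin.sum_univ_three]
  ring

/-- The leading part of the second-order term of the star product. -/
noncomputable def normalOrderedTerm (u : Fin 3 → MvPolynomial (Fin 3) k) :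
    MvPolynomial (Fin 3) k →ₗ[k] MvPolynomial (Fin 3) k →ₗ[k] MvPolynomial (Fin 3) k :=
  ∑ i, ∑ j, bidifferential 1 ((pderiv i).toLinearMap ∘ₗ (pderiv j).toLinearMap)
    (coordinateField u i ∘ₗ coordinateField u j)

theorem normalOrderedTerm_apply (u : Fin 3 → MvPolynomial (Fin 3) k)
    (a b : MvPolynomial (Fin 3) k) : normalOrderedTerm u a b =
      ∑ i, ∑ j, pderiv i (pderiv j a) * coordinateField u i (coordinateField u j b) := by
  simp [normalOrderedTerm]

/-- With `ξᵢ = coordinateField u i`, half of `normalOrderedTerm` is the `t²`-coefficient of `exp(t ∑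
∂ᵢ ⊗ ξᵢ)`, which would be an associative product if all `∂ᵢ` and `ξⱼ` commuted. So only commutators
remain on the right. -/
theorem normalOrderedTerm_spec (u : Fin 3 → MvPolynomial (Fin 3) k)
    (a b c : MvPolynomial (Fin 3) k) :
    2 * (bivectorBracket u (bivectorBracket u a b) c - bivectorBracket u a (bivectorBracket u b c))
      - (a * normalOrderedTerm u b c - normalOrderedTerm u (a * b) c
        + normalOrderedTerm u a (b * c) - normalOrderedTerm u a b * c) =
    ∑ i, ∑ j, (2 * pderiv i a * (pderiv j (coordinateField u i b) - coordinateField u i (pderiv j b))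
        * coordinateField u j c
      - pderiv i a * pderiv j b * (coordinateField u i (coordinateField u j c) -
        coordinateField u j (coordinateField u i c))) := by
  simp only [normalOrderedTerm_apply, bivectorBracket_eq_sum, Fin.sum_univ_three, map_add,
    LinearMap.add_apply, Derivation.leibniz, coordinateField_mul, smul_eq_mul, pderiv_comm 1 0,
    pderiv_comm 2 0, pderiv_comm 2 1]
  ring

/-- The coefficients `π(π^{ij}, xₗ)`. -/
noncomputable def jacobiTensor (u : Fin 3 → MvPolynomial (Fin 3) k) (i j l : Fin 3) :
    MvPolynomial (Fin 3) k := -coordinateField u l (bivectorMatrix u i j)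

/-- The part of the second-order term of the star product that involves derivatives of the
bivector field. -/
noncomputable def jacobiTerm (u : Fin 3 → MvPolynomial (Fin 3) k) :
    MvPolynomial (Fin 3) k →ₗ[k] MvPolynomial (Fin 3) k →ₗ[k] MvPolynomial (Fin 3) k :=
  ∑ i, ∑ j, ∑ l, (bidifferential (2 * jacobiTensor u i j l) (pderiv i).toLinearMap
      ((pderiv j).toLinearMap ∘ₗ (pderiv l).toLinearMap) +
    bidifferential (jacobiTensor u i l j) ((pderiv i).toLinearMap ∘ₗ (pderiv j).toLinearMap)
      (pderiv l).toLinearMap)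

theorem jacobiTerm_apply (u : Fin 3 → MvPolynomial (Fin 3) k)
    (a b : MvPolynomial (Fin 3) k) : jacobiTerm u a b =
      ∑ i, ∑ j, ∑ l, (2 * jacobiTensor u i j l * pderiv i a * pderiv j (pderiv l b) +
        jacobiTensor u i l j * pderiv i (pderiv j a) * pderiv l b) := by
  simp [jacobiTerm]

theorem jacobiTensor_anti (u : Fin 3 → MvPolynomial (Fin 3) k) (i j l : Fin 3) :
    jacobiTensor u i j l = - jacobiTensor u j i l := by
  fin_cases i <;> fin_cases j <;> simp [jacobiTensor, bivectorMatrix]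

/-- The hypothesis `u · curl u = 0` is the Jacobi identity for the three coordinates. -/
theorem jacobiTensor_cyclic (u : Fin 3 → MvPolynomial (Fin 3) k)
    (hu : u 0 * (pderiv 1 (u 2) - pderiv 2 (u 1)) + u 1 * (pderiv 2 (u 0) - pderiv 0 (u 2))
      + u 2 * (pderiv 0 (u 1) - pderiv 1 (u 0)) = 0) :
    jacobiTensor u 2 0 1 = - jacobiTensor u 0 1 2 - jacobiTensor u 1 2 0 := by
  simp [jacobiTensor, bivectorMatrix, coordinateField_apply, Fin.sum_univ_three]
  linear_combination hu

/-- The coboundary of `∂ᵢ ⊗ ∂ⱼ∂ₗ` is `∂ᵢ ⊗ (∂ⱼ ⊗ ∂ₗ + ∂ₗ ⊗ ∂ⱼ)`, and that of `∂ᵢ∂ⱼ ⊗ ∂ₗ` is `-(∂ᵢ ⊗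
∂ⱼ + ∂ⱼ ⊗ ∂ᵢ) ⊗ ∂ₗ`. Writing `J` for `jacobiTensor u`, the coefficient of `∂ᵢ ⊗ ∂ⱼ ⊗ ∂ₗ` is
therefore `2 Jᵢⱼₗ + Jᵢₗⱼ - Jⱼₗᵢ = 2 Jᵢⱼₗ - Jₗᵢⱼ - Jⱼₗᵢ`, which is `3 Jᵢⱼₗ` by the cyclic identity.
-/
theorem jacobiTerm_spec (u : Fin 3 → MvPolynomial (Fin 3) k)
    (hu : u 0 * (pderiv 1 (u 2) - pderiv 2 (u 1)) + u 1 * (pderiv 2 (u 0) - pderiv 0 (u 2))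
      + u 2 * (pderiv 0 (u 1) - pderiv 1 (u 0)) = 0) (a b c : MvPolynomial (Fin 3) k) :
    a * jacobiTerm u b c - jacobiTerm u (a * b) c + jacobiTerm u a (b * c) - jacobiTerm u a b * c
      = 3 * ∑ i, ∑ j, ∑ l, jacobiTensor u i j l * pderiv i a * pderiv j b * pderiv l c := by
  have h0 (i l) : jacobiTensor u i i l = 0 := by
    fin_cases i <;> simp [jacobiTensor, bivectorMatrix]
  simp only [jacobiTerm_apply, Fin.sum_univ_three, map_add, Derivation.leibniz, smul_eq_mul,
    pderiv_comm 1 0, pderiv_comm 2 0, pderiv_comm 2 1, h0, jacobiTensor_cyclic u hu,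
    jacobiTensor_anti u 1 0, jacobiTensor_anti u 2 1, jacobiTensor_anti u 0 2]
  ring

/-- Both kinds of commutators are expressed by first derivatives of `π`; the second cancels half of
the first. The defect is thus a third of the coboundary of `jacobiTerm`. -/
theorem normalOrderedTerm_defect (u : Fin 3 → MvPolynomial (Fin 3) k)
    (hu : u 0 * (pderiv 1 (u 2) - pderiv 2 (u 1)) + u 1 * (pderiv 2 (u 0) - pderiv 0 (u 2))
      + u 2 * (pderiv 0 (u 1) - pderiv 1 (u 0)) = 0) (a b c : MvPolynomial (Fin 3) k) :
    ∑ i, ∑ j, (2 * pderiv i a * (pderiv j (coordinateField u i b) - coordinateField u i (pderiv j b))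
        * coordinateField u j c
      - pderiv i a * pderiv j b * (coordinateField u i (coordinateField u j c) -
        coordinateField u j (coordinateField u i c))) =
    ∑ i, ∑ j, ∑ l, jacobiTensor u i j l * pderiv i a * pderiv j b * pderiv l c := by
  have h1 (i j : Fin 3) : pderiv j (coordinateField u i b) - coordinateField u i (pderiv j b) =
      ∑ l, pderiv j (bivectorMatrix u i l) * pderiv l b := by
    simp only [coordinateField_apply, map_sum, Derivation.leibniz, smul_eq_mul,
      ← Finset.sum_sub_distrib]
    refine Finset.sum_congr rfl fun l _ => ?_
    rw [pderiv_comm j l]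
    ring
  -- By the Jacobi identity, the commutator of the Hamiltonian fields of `xᵢ` and `xⱼ` is the
  -- Hamiltonian field of `π^{ij}`.
  have h2 (i j : Fin 3) : coordinateField u i (coordinateField u j c) -
      coordinateField u j (coordinateField u i c) =
      ∑ l, pderiv l (bivectorMatrix u i j) * coordinateField u l c := by
    simp only [coordinateField_apply]
    fin_cases i <;> fin_cases j <;>
      simp only [bivectorMatrix, Fin.sum_univ_three, Fin.isValue, Fin.zero_eta, Fin.mk_one,
        Fin.reduceFinMk, Matrix.cons_val, zero_mul, map_add, map_zero, map_neg, Derivation.leibniz,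
        smul_eq_mul, pderiv_comm 1 0, pderiv_comm 2 0, pderiv_comm 2 1, neg_mul]
    · ring
    · linear_combination -hu * pderiv 2 c
    · linear_combination hu * pderiv 1 c
    · linear_combination hu * pderiv 2 c
    · ring
    · linear_combination -hu * pderiv 0 c
    · linear_combination -hu * pderiv 1 c
    · linear_combination hu * pderiv 0 c
    · ring
  simp only [h1, h2, Fin.sum_univ_three, jacobiTensor]
  simp only [coordinateField_apply, Fin.sum_univ_three]
  simp only [bivectorMatrix, Fin.isValue, Matrix.cons_val, map_zero, map_neg]
  ring

/-- A bivector field on affine space with vanishing Schouten square defines an infinitesimal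
deformation that extends to second order with a symmetric second-order term. -/
theorem exists_symmetric_second_order [CharZero k] (u : Fin 3 → MvPolynomial (Fin 3) k)
    (hu : u 0 * (pderiv 1 (u 2) - pderiv 2 (u 1)) + u 1 * (pderiv 2 (u 0) - pderiv 0 (u 2))
      + u 2 * (pderiv 0 (u 1) - pderiv 1 (u 0)) = 0) :
    ∃ m : MvPolynomial (Fin 3) k →ₗ[k] MvPolynomial (Fin 3) k →ₗ[k] MvPolynomial (Fin 3) k,
      (∀ a b, m a b = m b a) ∧ ∀ a b c,
        bivectorBracket u (bivectorBracket u a b) c - bivectorBracket u a (bivectorBracket u b c) =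
          a * m b c - m (a * b) c + m a (b * c) - m a b * c := by
  have anti (a b) : bivectorBracket u a b = -bivectorBracket u b a := by
    simp only [bivectorBracket_apply]; ring
  let m6 := (3 : k) • normalOrderedTerm u + jacobiTerm u
  have h6 (a b c) : 6 * (bivectorBracket u (bivectorBracket u a b) c -
      bivectorBracket u a (bivectorBracket u b c)) =
        a * m6 b c - m6 (a * b) c + m6 a (b * c) - m6 a b * c := by
    have e1 := normalOrderedTerm_spec u a b c
    have e2 := jacobiTerm_spec u hu a b c
    rw [normalOrderedTerm_defect u hu] at e1
    have e3 (a b) : m6 a b = 3 * normalOrderedTerm u a b + jacobiTerm u a b := by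
      simp only [m6, LinearMap.add_apply, LinearMap.smul_apply, ofNat_smul_eq_nsmul]
      simp
    simp only [e3]
    linear_combination 3 * e1 - e2
  have hC : C (1 / 12 : k) * 12 = (1 : MvPolynomial (Fin 3) k) := by
    rw [← map_ofNat C 12, ← map_mul]
    norm_num
  -- Reversing `a, b, c` negates the left side, the bracket being skew, and turns the coboundary of
  -- `m6` into minus that of its flip. So the flip solves the same equation as `m6`, and `1/12`
  -- averages the two solutions after division by 6.
  refine ⟨(1 / 12 : k) • (m6 + m6.flip), fun a b => ?_, fun a b c => ?_⟩
  · simp [add_comm]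
  · simp only [LinearMap.smul_apply, LinearMap.add_apply, LinearMap.flip_apply, smul_eq_C_mul]
    have e1 := h6 a b c
    have e2 := h6 c b a
    rw [anti (bivectorBracket u c b) a, anti c (bivectorBracket u b a), anti c b, anti b a,
      mul_comm c b, mul_comm b a] at e2
    simp only [map_neg, LinearMap.neg_apply] at e2
    linear_combination C (1 / 12 : k) * (e1 - e2) - (bivectorBracket u (bivectorBracket u a b) c -
      bivectorBracket u a (bivectorBracket u b c)) * hC

end Star

/-! ### Symmetric cocycles, skew biderivations and division with remainder -/

/-- A commutative square-zero extension of `A` by itself, given by a symmetric `2`-cocycle. -/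
@[ext] structure CocycleExtension {k A : Type*} [CommRing k] [CommRing A] [Algebra k A]
    (_f : A →ₗ[k] A →ₗ[k] A) where
  fst : A
  snd : A

/-- A symmetric `2`-cocycle becomes a coboundary on a polynomial ring. -/
theorem exists_primitive_of_symmetric {k A σ : Type*} [CommRing k] [CommRing A] [Algebra k A]
    (f : A →ₗ[k] A →ₗ[k] A) (hf : ∀ a b c, a * f b c - f (a * b) c + f a (b * c) - f a b * c = 0)
    (hsymm : ∀ a b, f a b = f b a) (pr : MvPolynomial σ k →ₐ[k] A) :
    ∃ h : MvPolynomial σ k →ₗ[k] A, ∀ a b, f (pr a) (pr b) = pr a * h b - h (a * b) + h a * pr b := by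
  let E := CocycleExtension f
  have h1 (a : A) : f 1 a = f 1 1 * a := by
    have := hf 1 1 a
    simp only [one_mul] at this
    linear_combination this
  let _ : Zero E := ⟨⟨0, 0⟩⟩
  -- The cocycle is not assumed normalized, so `(1, 0)` need not be the unit; `h1` gives the
  -- correction.
  let _ : One E := ⟨⟨1, f 1 1⟩⟩
  let _ : Add E := ⟨fun x y => ⟨x.1 + y.1, x.2 + y.2⟩⟩
  let _ : Neg E := ⟨fun x => ⟨-x.1, -x.2⟩⟩
  let _ : Sub E := ⟨fun x y => ⟨x.1 - y.1, x.2 - y.2⟩⟩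
  let _ : Mul E := ⟨fun x y => ⟨x.1 * y.1, x.1 * y.2 + x.2 * y.1 - f x.1 y.1⟩⟩
  let _ : SMul k E := ⟨fun c x => ⟨c • x.1, c • x.2⟩⟩
  have mul_comm' (x y : E) : x * y = y * x :=
    CocycleExtension.ext (mul_comm _ _) (by
      change x.1 * y.2 + x.2 * y.1 - f x.1 y.1 = y.1 * x.2 + y.2 * x.1 - f y.1 x.1
      rw [hsymm]; ring)
  have one_mul' (x : E) : 1 * x = x :=
    CocycleExtension.ext (one_mul _) (by
      change 1 * x.2 + f 1 1 * x.1 - f 1 x.1 = x.2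
      linear_combination -h1 x.1)
  have left_distrib' (x y z : E) : x * (y + z) = x * y + x * z :=
    CocycleExtension.ext (mul_add _ _ _) (by
      change x.1 * (y.2 + z.2) + x.2 * (y.1 + z.1) - f x.1 (y.1 + z.1) =
        x.1 * y.2 + x.2 * y.1 - f x.1 y.1 + (x.1 * z.2 + x.2 * z.1 - f x.1 z.1)
      rw [map_add]; ring)
  have zero_mul' (x : E) : 0 * x = 0 :=
    CocycleExtension.ext (zero_mul _) (by
      change 0 * x.2 + 0 * x.1 - f 0 x.1 = 0
      simp)
  let _ : CommRing E :=
    { add_assoc := fun _ _ _ => CocycleExtension.ext (add_assoc _ _ _) (add_assoc _ _ _)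
      zero_add := fun _ => CocycleExtension.ext (zero_add _) (zero_add _)
      add_zero := fun _ => CocycleExtension.ext (add_zero _) (add_zero _)
      add_comm := fun _ _ => CocycleExtension.ext (add_comm _ _) (add_comm _ _)
      neg_add_cancel := fun _ => CocycleExtension.ext (neg_add_cancel _) (neg_add_cancel _)
      sub_eq_add_neg := fun _ _ => CocycleExtension.ext (sub_eq_add_neg _ _) (sub_eq_add_neg _ _)
      mul_assoc := fun x y z => CocycleExtension.ext (mul_assoc _ _ _) (by
        change x.1 * y.1 * z.2 + (x.1 * y.2 + x.2 * y.1 - f x.1 y.1) * z.1 - f (x.1 * y.1) z.1 =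
          x.1 * (y.1 * z.2 + y.2 * z.1 - f y.1 z.1) + x.2 * (y.1 * z.1) - f x.1 (y.1 * z.1)
        linear_combination hf x.1 y.1 z.1)
      mul_comm := mul_comm'
      one_mul := one_mul'
      mul_one := fun x => (mul_comm' _ _).trans (one_mul' x)
      left_distrib := left_distrib'
      right_distrib := fun x y z => by
        rw [mul_comm', left_distrib', mul_comm' z, mul_comm' z]
      zero_mul := zero_mul'
      mul_zero := fun x => (mul_comm' _ _).trans (zero_mul' x)
      nsmul := nsmulRec
      zsmul := zsmulRec }
  let _ : Module k E :=
    { one_smul := fun _ => CocycleExtension.ext (one_smul _ _) (one_smul _ _)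
      mul_smul := fun _ _ _ => CocycleExtension.ext (mul_smul _ _ _) (mul_smul _ _ _)
      smul_zero := fun _ => CocycleExtension.ext (smul_zero _) (smul_zero _)
      smul_add := fun _ _ _ => CocycleExtension.ext (smul_add _ _ _) (smul_add _ _ _)
      add_smul := fun _ _ _ => CocycleExtension.ext (add_smul _ _ _) (add_smul _ _ _)
      zero_smul := fun _ => CocycleExtension.ext (zero_smul _ _) (zero_smul _ _) }
  have smul_mul' (c : k) (x y : E) : c • x * y = c • (x * y) :=
    CocycleExtension.ext (smul_mul_assoc _ _ _) (by
      change (c • x.1) * y.2 + (c • x.2) * y.1 - f (c • x.1) y.1 =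
        c • (x.1 * y.2 + x.2 * y.1 - f x.1 y.1)
      simp [smul_sub, smul_add])
  let _ : Algebra k E := Algebra.ofModule smul_mul' (fun c x y => by
    rw [mul_comm x, smul_mul', mul_comm y])
  let π₁ : E →ₐ[k] A :=
    { toFun := CocycleExtension.fst
      map_one' := rfl
      map_mul' := fun _ _ => rfl
      map_zero' := rfl
      map_add' := fun _ _ => rfl
      commutes' := fun c => by
        rw [Algebra.algebraMap_eq_smul_one, Algebra.algebraMap_eq_smul_one]
        rfl }
  -- Any lift of the coordinates extends to an algebra map into the extension; its second component
  -- is the primitive.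
  let φ : MvPolynomial σ k →ₐ[k] E := aeval fun i => ⟨pr (X i), 0⟩
  have hφ : π₁.comp φ = pr := by
    ext i
    simp only [φ, AlgHom.comp_apply, aeval_X]
    rfl
  have hφ' (r) : (φ r).1 = pr r := congrArg (fun g : MvPolynomial σ k →ₐ[k] A => g r) hφ
  let π₂ : E →ₗ[k] A :=
    { toFun := CocycleExtension.snd
      map_add' := fun _ _ => rfl
      map_smul' := fun _ _ => rfl }
  refine ⟨π₂ ∘ₗ φ.toLinearMap, fun a b => ?_⟩
  have key : (φ (a * b)).2 = (φ a).1 * (φ b).2 + (φ a).2 * (φ b).1 - f (φ a).1 (φ b).1 := by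
    rw [map_mul]; rfl
  rw [hφ', hφ'] at key
  change f (pr a) (pr b) = pr a * (φ b).2 - (φ (a * b)).2 + (φ a).2 * pr b
  rw [key]; ring

/-- The antisymmetrization of a `2`-cocycle of a commutative algebra is a derivation in its first
argument. -/
theorem antisymmetrization_mul {k A : Type*} [CommRing k] [CommRing A] [Algebra k A]
    {f : A →ₗ[k] A →ₗ[k] A} (hf : ∀ a b c, a * f b c - f (a * b) c + f a (b * c) - f a b * c = 0)
    (a b c : A) : f (a * b) c - f c (a * b) = a * (f b c - f c b) + b * (f a c - f c a) := by
  have e1 := hf a b c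
  have e2 := hf c a b
  have e3 := hf a c b
  rw [mul_comm c a] at e2
  rw [mul_comm c b] at e3
  linear_combination -e1 - e2 + e3

theorem derivation_eq_sum_pderiv {k M : Type*} [CommRing k] [AddCommGroup M] [Module k M]
    [Module (MvPolynomial (Fin 3) k) M] [IsScalarTower k (MvPolynomial (Fin 3) k) M]
    (D : Derivation k (MvPolynomial (Fin 3) k) M) (a : MvPolynomial (Fin 3) k) :
    D a = pderiv 0 a • D (X 0) + pderiv 1 a • D (X 1) + pderiv 2 a • D (X 2) := by
  have h : D = (LinearMap.toSpanSingleton _ M (D (X 0))).compDer (pderiv 0) +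
      (LinearMap.toSpanSingleton _ M (D (X 1))).compDer (pderiv 1) +
      (LinearMap.toSpanSingleton _ M (D (X 2))).compDer (pderiv 2) := by
    refine derivation_ext fun i => ?_
    fin_cases i <;> simp [pderiv_X]
  exact congrArg (fun D => D a) h

/-- A skew biderivation along `k[x₀, x₁, x₂] → A` is determined by its values on coordinates. -/
theorem skew_biderivation_apply {k A : Type*} [CommRing k] [CommRing A] [Algebra k A]
    (pr : MvPolynomial (Fin 3) k →ₐ[k] A) (g : A →ₗ[k] A →ₗ[k] A)
    (hskew : ∀ a b, g a b = -g b a) (hself : ∀ a, g a a = 0)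
    (hder : ∀ a b c, g (a * b) c = a * g b c + b * g a c) (a b : MvPolynomial (Fin 3) k) :
    g (pr a) (pr b) =
      g (pr (X 1)) (pr (X 2)) * pr (pderiv 1 a * pderiv 2 b - pderiv 2 a * pderiv 1 b)
      + g (pr (X 2)) (pr (X 0)) * pr (pderiv 2 a * pderiv 0 b - pderiv 0 a * pderiv 2 b)
      + g (pr (X 0)) (pr (X 1)) * pr (pderiv 0 a * pderiv 1 b - pderiv 1 a * pderiv 0 b) := by
  -- With `A` a module over the polynomial ring through `pr`, each `r ↦ g (pr r) x` is a derivation,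
  -- determined by its values on the coordinates.
  let _ : Algebra (MvPolynomial (Fin 3) k) A := pr.toRingHom.toAlgebra
  have : IsScalarTower k (MvPolynomial (Fin 3) k) A :=
    IsScalarTower.of_algebraMap_eq fun c => (pr.commutes c).symm
  have hsmul (r : MvPolynomial (Fin 3) k) (x : A) : r • x = pr r * x := rfl
  have expand (x : A) (r) : g (pr r) x = pr (pderiv 0 r) * g (pr (X 0)) x +
      pr (pderiv 1 r) * g (pr (X 1)) x + pr (pderiv 2 r) * g (pr (X 2)) x :=
    derivation_eq_sum_pderiv (Derivation.mk' (g.flip x ∘ₗ pr.toLinearMap) fun a b => by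
      simp only [LinearMap.comp_apply, AlgHom.toLinearMap_apply, map_mul, LinearMap.flip_apply,
        hder, hsmul]) r
  rw [expand, hskew _ (pr b), hskew _ (pr b), hskew _ (pr b), expand _ b, expand _ b, expand _ b,
    hself, hself, hself, hskew (pr (X 1)) (pr (X 0)), hskew (pr (X 2)) (pr (X 1)),
    hskew (pr (X 0)) (pr (X 2))]
  simp only [map_sub, map_mul]
  ring

/-- A linear section of the quotient of a domain by a nonzero principal ideal determines a linear
quotient operator, as in division with remainder. -/
theorem exists_quotient_operator {k R A : Type*} [Field k] [CommRing R] [IsDomain R] [Algebra k R]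
    [CommRing A] [Algebra k A] (pr : R →ₐ[k] A) (hpr : Function.Surjective pr) (F : R) (hF : F ≠ 0)
    (hker : ∀ r, pr r = 0 ↔ F ∣ r) :
    ∃ (s : A →ₗ[k] R) (q : R →ₗ[k] R), (∀ a, pr (s a) = a) ∧ (∀ r, r = s (pr r) + F * q r) ∧
      ∀ r, q (F * r) = r := by
  obtain ⟨s, hs⟩ := pr.toLinearMap.exists_rightInverse_of_surjective (LinearMap.range_eq_top.2 hpr)
  have hs' (a : A) : pr (s a) = a := congrArg (fun g => g a) hs
  have hex (r : R) : ∃ t, r - s (pr r) = F * t := (hker _).1 (by simp [hs'])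
  choose q hq using hex
  -- The quotient is unique because `F` can be cancelled; this makes the chosen `q` linear.
  let q' : R →ₗ[k] R :=
    { toFun := q
      map_add' := fun a b => mul_left_cancel₀ hF (by
        rw [mul_add, ← hq, ← hq, ← hq, map_add, map_add]; ring)
      map_smul' := fun c a => mul_left_cancel₀ hF (by
        rw [RingHom.id_apply, mul_smul_comm, ← hq, ← hq, map_smul, map_smul, smul_sub]) }
  refine ⟨s, q', hs', fun r => ?_, fun r => ?_⟩
  · exact (sub_eq_iff_eq_add'.1 (hq r))
  · refine mul_left_cancel₀ hF ?_
    change F * q (F * r) = _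
    rw [← hq, (hker _).2 (dvd_mul_right _ _), map_zero, sub_zero]

/-! ### Bilinear maps as Hochschild cochains -/

section Bilinear

variable {k : Type*} [CommRing k] {A : Type*} [CommRing A] [Algebra k A]

namespace Hochschild

/-- A `2`-cochain as a bilinear map. -/
def Cochain.toBilinear (f : Cochain k A 2) : A →ₗ[k] A →ₗ[k] A :=
  LinearMap.mk₂ k (fun a b => f ![a, b]) (two_add_left f) (two_smul_left f) (two_add_right f)
    fun c a b => two_smul_right f a c b

@[simp] theorem Cochain.toBilinear_apply (f : Cochain k A 2) (a b : A) :
    f.toBilinear a b = f ![a, b] := rfl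

/-- A bilinear map as a `2`-cochain. -/
def Cochain.ofBilinear (g : A →ₗ[k] A →ₗ[k] A) : Cochain k A 2 :=
  Cochain.mk (fun a => g (a 0) (a 1))
    (fun a i x y => by fin_cases i <;> simp)
    (fun a i c x => by fin_cases i <;> simp)

@[simp] theorem Cochain.ofBilinear_apply (g : A →ₗ[k] A →ₗ[k] A) (a b : A) :
    Cochain.ofBilinear g ![a, b] = g a b := rfl

/-- A linear map as a `1`-cochain. -/
def Cochain.ofLinear (g : A →ₗ[k] A) : Cochain k A 1 :=
  Cochain.mk (fun a => g (a 0))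
    (fun a i x y => by fin_cases i; simp)
    (fun a i c x => by fin_cases i; simp)

@[simp] theorem Cochain.ofLinear_apply (g : A →ₗ[k] A) (a : A) :
    Cochain.ofLinear g ![a] = g a := rfl

/-- Since `[f, f] = 2 f ∘ f`, the second-order term `g` of a deformation that starts with `f` gives
the primitive `g + g`. -/
theorem bracketTwo_self_mem_coboundaries {f : Cochain k A 2} (g : A →ₗ[k] A →ₗ[k] A)
    (hg : ∀ a b c, f ![f ![a, b], c] - f ![a, f ![b, c]] =
      a * g b c - g (a * b) c + g a (b * c) - g a b * c) :
    bracketTwo k A f f ∈ coboundaries k A 3 := by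
  refine ⟨Cochain.ofBilinear (g + g), ?_⟩
  ext v
  rw [eq_vec3 v, d_two_apply, bracketTwo_apply, hg]
  simp only [Cochain.ofBilinear_apply, LinearMap.add_apply]
  ring

theorem d_one_mem_cocycles (h : Cochain k A 1) : d k A 1 h ∈ cocycles k A 2 := by
  change d k A 2 _ = 0
  ext v
  rw [eq_vec3 v, d_two_apply]
  simp only [d_one_apply, Cochain.zero_apply, mul_assoc]
  ring

theorem exists_toHH_eq_sub_d_one (f : cocycles k A 2) (h : Cochain k A 1) :
    ∃ f' : cocycles k A 2, f'.1 = f.1 - d k A 1 h ∧ toHH 2 f = toHH 2 f' := by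
  have hd : toHH 2 (⟨d k A 1 h, d_one_mem_cocycles h⟩ : cocycles k A 2) = 0 :=
    (toHH_eq_zero_iff _).2 ⟨h, rfl⟩
  exact ⟨f - ⟨d k A 1 h, d_one_mem_cocycles h⟩, rfl, by rw [map_sub, hd, sub_zero]⟩

theorem toHH_surjective (n : ℕ) : Function.Surjective (toHH (k := k) (A := A) n) :=
  Submodule.mkQ_surjective _

end Hochschild

end Bilinear

/-! ### Cocycles on a surface in affine three-space -/

section Hypersurface

variable {k : Type*} [Field k]

theorem bivectorBracket_cocycle (u : Fin 3 → MvPolynomial (Fin 3) k)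
    (a b c : MvPolynomial (Fin 3) k) :
    a * bivectorBracket u b c - bivectorBracket u (a * b) c + bivectorBracket u a (b * c)
      - bivectorBracket u a b * c = 0 := by
  simp only [bivectorBracket_apply, Derivation.leibniz, smul_eq_mul]
  ring

/-- On a surface `F = 0` in affine space, the infinitesimal deformation given by a multiple of the
Jacobian Poisson structure and a perturbation `p` of the equation extends to second order. -/
theorem exists_second_order_of_hypersurface [CharZero k] {A : Type*} [CommRing A] [Algebra k A]
    (pr : MvPolynomial (Fin 3) k →ₐ[k] A) (s : A →ₗ[k] MvPolynomial (Fin 3) k)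
    (q : MvPolynomial (Fin 3) k →ₗ[k] MvPolynomial (Fin 3) k) (F p α : MvPolynomial (Fin 3) k)
    (hs : ∀ a, pr (s a) = a) (hF : pr F = 0) (hq : ∀ r, r = s (pr r) + F * q r)
    (hqF : ∀ r, q (F * r) = r) (f : A → A → A)
    (hf : ∀ a b, f a b = pr (bivectorBracket (fun i => α * pderiv i F) (s a) (s b)) -
      pr (p * q (s a * s b))) :
    ∃ g : A →ₗ[k] A →ₗ[k] A, ∀ a b c, f (f a b) c - f a (f b c) =
      a * g b c - g (a * b) c + g a (b * c) - g a b * c := by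
  -- The Schouten square vanishes because `curl (α∇F) = ∇α × ∇F` is orthogonal to `∇F`.
  obtain ⟨m, hm, hm2⟩ := exists_symmetric_second_order (fun i => α * pderiv i F) (by
    simp only [Derivation.leibniz, smul_eq_mul, pderiv_comm 1 0, pderiv_comm 2 0, pderiv_comm 2 1]
    ring)
  -- The added bracket is a cocycle, so the equation for `m` persists. In the condition that `F +
  -- tp` be central, `α det(∇p, ∇F, ∇r)` cancels `α det(∇F, ∇p, ∇r)`, and the symmetry of `m`
  -- settles the rest.
  refine exists_second_order_of_quotient pr s q F p hs hF hq hqF _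
    (m + bivectorBracket fun i => α * pderiv i p) (bivectorBracket_cocycle _) (fun a b c => ?_)
    (fun r => ?_) (fun r => ?_) (fun r => ?_) f hf
  · simp only [LinearMap.add_apply]
    linear_combination hm2 a b c - bivectorBracket_cocycle (fun i => α * pderiv i p) a b c
  · simp only [bivectorBracket_apply]; ring
  · simp only [bivectorBracket_apply]; ring
  · simp only [bivectorBracket_apply, LinearMap.add_apply, hm r F]; ring

/-- A `2`-cocycle of a commutative algebra is the sum of a skew biderivation and a symmetric
cocycle. -/
theorem exists_skew_add_symmetric [CharZero k] {A : Type*} [CommRing A] [Algebra k A]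
    (B : A →ₗ[k] A →ₗ[k] A)
    (hB : ∀ a b c, a * B b c - B (a * b) c + B a (b * c) - B a b * c = 0) :
    ∃ T S : A →ₗ[k] A →ₗ[k] A, (∀ a b, B a b = T a b + S a b) ∧ (∀ a b, T a b = -T b a) ∧
      (∀ a, T a a = 0) ∧ (∀ a b c, T (a * b) c = a * T b c + b * T a c) ∧
      (∀ a b c, a * S b c - S (a * b) c + S a (b * c) - S a b * c = 0) ∧
      ∀ a b, S a b = S b a := by
  obtain ⟨T, hT⟩ : ∃ T : A →ₗ[k] A →ₗ[k] A, ∀ a b, T a b = (1 / 2 : k) • (B a b - B b a) :=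
    ⟨(1 / 2 : k) • (B - B.flip), fun _ _ => rfl⟩
  obtain ⟨S, hS⟩ : ∃ S : A →ₗ[k] A →ₗ[k] A, ∀ a b, S a b = (1 / 2 : k) • (B a b + B b a) :=
    ⟨(1 / 2 : k) • (B + B.flip), fun _ _ => rfl⟩
  refine ⟨T, S, fun a b => ?_, fun a b => ?_, fun a => ?_, fun a b c => ?_, fun a b c => ?_,
    fun a b => ?_⟩
  · rw [hS, hT, ← smul_add, sub_add_add_cancel, ← two_smul k, smul_smul]
    norm_num
  · rw [hT, hT, ← smul_neg, neg_sub]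
  · rw [hT, sub_self, smul_zero]
  · simp only [hT, mul_smul_comm, ← smul_add, antisymmetrization_mul hB]
  · have e := hB c b a
    rw [mul_comm c b, mul_comm b a] at e
    simp only [hS, mul_smul_comm, smul_mul_assoc, ← smul_sub, ← smul_add]
    rw [show a * (B b c + B c b) - (B (a * b) c + B c (a * b)) + (B a (b * c) + B (b * c) a) -
      (B a b + B b a) * c = 0 by linear_combination hB a b c - e, smul_zero]
  · rw [hS, hS, add_comm]

/-- A skew biderivation on a surface `F = 0` whose gradient has exact Koszul complex is a multiple
of the Jacobian Poisson structure. -/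
theorem exists_eq_bivectorBracket {A : Type*} [CommRing A] [Algebra k A]
    (pr : MvPolynomial (Fin 3) k →ₐ[k] A) (hpr : Function.Surjective pr)
    (F : MvPolynomial (Fin 3) k) (hF : pr F = 0)
    (hkoszul : ∀ v : Fin 3 → A, v 1 * pr (pderiv 2 F) = v 2 * pr (pderiv 1 F) →
      v 2 * pr (pderiv 0 F) = v 0 * pr (pderiv 2 F) → ∃ a, ∀ i, v i = a * pr (pderiv i F))
    (T : A →ₗ[k] A →ₗ[k] A) (hskew : ∀ a b, T a b = -T b a) (hself : ∀ a, T a a = 0)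
    (hder : ∀ a b c, T (a * b) c = a * T b c + b * T a c) :
    ∃ α, ∀ a b, T (pr a) (pr b) = pr (bivectorBracket (fun i => α * pderiv i F) a b) := by
  have hT := skew_biderivation_apply pr T hskew hself hder
  have hTF (b) : T (pr F) (pr b) = 0 := by rw [hF, map_zero, LinearMap.zero_apply]
  -- As `F` vanishes on the surface, `T(F, x₀) = T(F, x₁) = 0`; these are the two components of `v ×
  -- ∇F = 0` that `hkoszul` asks for.
  obtain ⟨α', hα'⟩ := hkoszul ![T (pr (X 1)) (pr (X 2)), T (pr (X 2)) (pr (X 0)),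
      T (pr (X 0)) (pr (X 1))] (by
        have := hT F (X 0)
        simp [hTF, pderiv_X] at this
        simp
        linear_combination -this) (by
        have := hT F (X 1)
        simp [hTF, pderiv_X] at this
        simp
        linear_combination -this)
  obtain ⟨α, rfl⟩ := hpr α'
  refine ⟨α, fun a b => ?_⟩
  have v0 := hα' 0
  have v1 := hα' 1
  have v2 := hα' 2
  simp only [Matrix.cons_val] at v0 v1 v2
  rw [hT, v0, v1, v2, bivectorBracket_apply]
  simp only [map_add, map_mul pr]

/-- The primitive `h` of the symmetric part lives on the polynomial ring, not on `A`. On the ideal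
`(F)` it is `F r ↦ p r`, so `h ∘ s` is a primitive up to `p` times the quotient of `s a * s b` by
`F`. -/
theorem exists_normal_form_of_hypersurface [CharZero k] {A : Type*} [CommRing A] [Algebra k A]
    (pr : MvPolynomial (Fin 3) k →ₐ[k] A) (hpr : Function.Surjective pr)
    (s : A →ₗ[k] MvPolynomial (Fin 3) k) (q : MvPolynomial (Fin 3) k →ₗ[k] MvPolynomial (Fin 3) k)
    (F : MvPolynomial (Fin 3) k) (hs : ∀ a, pr (s a) = a) (hF : pr F = 0)
    (hq : ∀ r, r = s (pr r) + F * q r)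
    (hkoszul : ∀ v : Fin 3 → A, v 1 * pr (pderiv 2 F) = v 2 * pr (pderiv 1 F) →
      v 2 * pr (pderiv 0 F) = v 0 * pr (pderiv 2 F) → ∃ a, ∀ i, v i = a * pr (pderiv i F))
    (B : A →ₗ[k] A →ₗ[k] A)
    (hB : ∀ a b c, a * B b c - B (a * b) c + B a (b * c) - B a b * c = 0) :
    ∃ (α p : MvPolynomial (Fin 3) k) (h : A →ₗ[k] A), ∀ a b,
      B a b - (a * h b - h (a * b) + h a * b) =
        pr (bivectorBracket (fun i => α * pderiv i F) (s a) (s b)) - pr (p * q (s a * s b)) := by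
  obtain ⟨T, S, hTS, hskew, hself, hder, hS, hsymm⟩ := exists_skew_add_symmetric B hB
  obtain ⟨α, hα⟩ := exists_eq_bivectorBracket pr hpr F hF hkoszul T hskew hself hder
  obtain ⟨h, hh⟩ := exists_primitive_of_symmetric S hS hsymm pr
  obtain ⟨p, hp⟩ := hpr (h F)
  have hhF (r) : h (F * r) = pr (p * r) := by
    have := hh F r
    rw [hF, map_zero, LinearMap.zero_apply] at this
    rw [map_mul pr, hp]
    linear_combination this
  refine ⟨α, p, h ∘ₗ s, fun a b => ?_⟩
  have e2 := hh (s a) (s b)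
  have e4 := congrArg h (hq (s a * s b))
  rw [map_add h, hhF, map_mul pr (s a), hs, hs] at e4
  rw [hs, hs] at e2
  rw [hTS, ← hα, hs, hs, e2]
  simp only [LinearMap.comp_apply]
  linear_combination -e4

theorem exists_bracketTwo_self_mem_coboundaries_of_hypersurface [CharZero k] {A : Type*}
    [CommRing A] [Algebra k A] (pr : MvPolynomial (Fin 3) k →ₐ[k] A)
    (hpr : Function.Surjective pr) (F : MvPolynomial (Fin 3) k) (hF0 : F ≠ 0)
    (hker : ∀ r, pr r = 0 ↔ F ∣ r)
    (hkoszul : ∀ v : Fin 3 → A, v 1 * pr (pderiv 2 F) = v 2 * pr (pderiv 1 F) →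
      v 2 * pr (pderiv 0 F) = v 0 * pr (pderiv 2 F) → ∃ a, ∀ i, v i = a * pr (pderiv i F))
    (f : Hochschild.cocycles k A 2) :
    ∃ f' : Hochschild.cocycles k A 2, Hochschild.toHH 2 f = Hochschild.toHH 2 f' ∧
      Hochschild.bracketTwo k A f' f' ∈ Hochschild.coboundaries k A 3 := by
  obtain ⟨s, q, hs, hq, hqF⟩ := exists_quotient_operator pr hpr F hF0 hker
  have hF : pr F = 0 := (hker F).2 dvd_rfl
  obtain ⟨α, p, h, hh⟩ := exists_normal_form_of_hypersurface pr hpr s q F hs hF hq hkoszul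
    f.1.toBilinear (Hochschild.cocycle_two f.2)
  obtain ⟨f', hf', hff'⟩ := Hochschild.exists_toHH_eq_sub_d_one f (Hochschild.Cochain.ofLinear h)
  obtain ⟨g, hg⟩ := exists_second_order_of_hypersurface pr s q F p α hs hF hq hqF
    (fun a b => f'.1 ![a, b]) fun a b => by
      rw [← hh, hf', Hochschild.Cochain.sub_apply, Hochschild.d_one_apply]
      simp only [Hochschild.Cochain.ofLinear_apply, Hochschild.Cochain.toBilinear_apply]
  exact ⟨f', hff', Hochschild.bracketTwo_self_mem_coboundaries g hg⟩

end Hypersurface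

/-! ### Koszul exactness for `xy = zⁿ⁺¹` -/

section GorensteinSurface

variable {k : Type*} [Field k] (n : ℕ)

/-- The equation of the surface. -/
noncomputable def surfaceEquation (k : Type*) [Field k] (n : ℕ) : MvPolynomial (Fin 3) k :=
  X 0 * X 1 - X 2 ^ (n + 1)

/-- The prime `z` does not divide `F`, since `F(1, 1, 0) = 1`. So `z` is a nonzerodivisor on the
surface. -/
theorem surface_X_two_dvd {r : MvPolynomial (Fin 3) k}
    (h : surfaceEquation k n ∣ X 2 * r) : surfaceEquation k n ∣ r := by
  obtain ⟨c, hc⟩ := h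
  have hF : ¬ (X 2 : MvPolynomial (Fin 3) k) ∣ surfaceEquation k n := by
    rintro ⟨e, he⟩
    have := congrArg (eval ![1, 1, 0]) he
    simp [surfaceEquation] at this
  obtain ⟨e, rfl⟩ := ((X_prime (i := (2 : Fin 3)) (R := k)).dvd_or_dvd ⟨r, hc.symm⟩).resolve_left hF
  exact ⟨e, mul_left_cancel₀ (X_ne_zero (2 : Fin 3)) (by rw [hc]; ring)⟩

theorem surface_X_two_pow_dvd (m : ℕ) {r : MvPolynomial (Fin 3) k}
    (h : surfaceEquation k n ∣ X 2 ^ m * r) : surfaceEquation k n ∣ r := by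
  induction m with
  | zero => simpa using h
  | succ m ih => exact ih (surface_X_two_dvd n (by rwa [← mul_assoc, ← pow_succ']))

theorem not_X_dvd_X_pow {i j : Fin 3} (hij : i ≠ j) (m : ℕ) :
    ¬ (X i : MvPolynomial (Fin 3) k) ∣ X j ^ m := fun h => by
  have := X_prime.dvd_of_dvd_pow h
  exact hij (X_dvd_X.1 this)

/-- Setting `x = 0` (the map `e`) leaves `z^m ∣ y b(0, y, z)`, and `y` is prime to `z`; moreover `x`
divides `b - b(0, y, z)`. -/
theorem exists_eq_of_dvd_X_one_mul (m : ℕ) (b d : MvPolynomial (Fin 3) k)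
    (h : X 2 ^ m ∣ X 1 * b - X 0 * d) : ∃ b₀ b₁, b = X 0 * b₀ + X 2 ^ m * b₁ := by
  let e : MvPolynomial (Fin 3) k →ₐ[k] MvPolynomial (Fin 3) k := aeval ![0, X 1, X 2]
  have he (r) : X 0 ∣ r - e r := by
    let π := Ideal.Quotient.mkₐ k (Ideal.span {(X 0 : MvPolynomial (Fin 3) k)})
    have h0 : π (X 0) = 0 := Ideal.Quotient.eq_zero_iff_mem.2 (Ideal.mem_span_singleton_self _)
    have : π = π.comp e := by
      ext i
      fin_cases i <;> simp [e, h0]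
    rw [← Ideal.mem_span_singleton, ← Ideal.Quotient.eq_zero_iff_mem]
    change π (r - e r) = 0
    rw [map_sub, sub_eq_zero]
    exact congrArg (fun g => g r) this
  obtain ⟨c, hc⟩ := h
  have h1 : X 2 ^ m ∣ X 1 * e b := ⟨e c, by simpa [e] using congrArg e hc⟩
  obtain ⟨b₁, hb₁⟩ : X 2 ^ m ∣ e b :=
    X_prime.pow_dvd_of_dvd_mul_left m (fun h => not_X_dvd_X_pow (k := k) (i := 2) (j := 1)
      (by decide) 1 (by rwa [pow_one])) h1
  obtain ⟨b₀, hb₀⟩ := he b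
  exact ⟨b₀, b₁, by linear_combination hb₀ + hb₁⟩

/-- In the polynomial ring, the ideal `(z^m, x y)` is the intersection of `(z^m, x)` and
`(z^m, y)`, hence contains every element that `x` and `y` multiply into it. -/
theorem exists_eq_of_X_mul_eq (m : ℕ) (w a b c d : MvPolynomial (Fin 3) k)
    (h0 : X 0 * w = X 2 ^ m * a + X 0 * X 1 * b) (h1 : X 1 * w = X 2 ^ m * c + X 0 * X 1 * d) :
    ∃ e₀ e₁, w = X 2 ^ m * e₀ + X 0 * X 1 * e₁ := by
  obtain ⟨a', rfl⟩ : X 0 ∣ a := (X_prime.dvd_or_dvd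
    (⟨w - X 1 * b, by linear_combination -h0⟩ : X 0 ∣ X 2 ^ m * a)).resolve_left
      (not_X_dvd_X_pow (by decide) m)
  obtain ⟨c', rfl⟩ : X 1 ∣ c := (X_prime.dvd_or_dvd
    (⟨w - X 0 * d, by linear_combination -h1⟩ : X 1 ∣ X 2 ^ m * c)).resolve_left
      (not_X_dvd_X_pow (by decide) m)
  have h0' : w = X 2 ^ m * a' + X 1 * b :=
    mul_left_cancel₀ (X_ne_zero (0 : Fin 3)) (by linear_combination h0)
  have h1' : w = X 2 ^ m * c' + X 0 * d :=
    mul_left_cancel₀ (X_ne_zero (1 : Fin 3)) (by linear_combination h1)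
  obtain ⟨b₀, b₁, rfl⟩ := exists_eq_of_dvd_X_one_mul m b d
    ⟨c' - a', by linear_combination h1' - h0'⟩
  exact ⟨a' + X 1 * b₁, b₀, by linear_combination h0'⟩

/-- Exactness of the Koszul complex of the partial derivatives of the equation at the place of
vector fields orthogonal to the gradient. -/
theorem surface_koszul [CharZero k] {A : Type*} [CommRing A] [Algebra k A]
    (pr : MvPolynomial (Fin 3) k →ₐ[k] A) (hpr : Function.Surjective pr)
    (hker : ∀ r, pr r = 0 ↔ surfaceEquation k n ∣ r) (v : Fin 3 → A)
    (h1 : v 1 * pr (pderiv 2 (surfaceEquation k n)) = v 2 * pr (pderiv 1 (surfaceEquation k n)))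
    (h2 : v 2 * pr (pderiv 0 (surfaceEquation k n)) = v 0 * pr (pderiv 2 (surfaceEquation k n))) :
    ∃ a, ∀ i, v i = a * pr (pderiv i (surfaceEquation k n)) := by
  have d0 : pderiv 0 (surfaceEquation k n) = X 1 := by
    simp [surfaceEquation, pderiv_X]
  have d1 : pderiv 1 (surfaceEquation k n) = X 0 := by
    simp [surfaceEquation, pderiv_X]
  have d2 : pderiv 2 (surfaceEquation k n) = C (-(n + 1) : k) * X 2 ^ n := by
    simp [surfaceEquation, pderiv_X]
    ring
  have hz (x : A) (hx : pr (X 2 ^ n) * x = 0) : x = 0 := by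
    obtain ⟨r, rfl⟩ := hpr x
    rw [← map_mul, hker] at hx
    exact (hker r).2 (surface_X_two_pow_dvd n n hx)
  have hc : C (-(n + 1) : k)⁻¹ * C (-(n + 1) : k) = (1 : MvPolynomial (Fin 3) k) := by
    rw [← map_mul, inv_mul_cancel₀ (neg_ne_zero.2 (Nat.cast_add_one_ne_zero n)), map_one]
  have hc' := congrArg pr hc
  have hxy : pr (X 0 * X 1) = pr (X 2 ^ n) * pr (X 2) := by
    rw [← map_mul, ← sub_eq_zero, ← map_sub, ← pow_succ]
    exact (hker _).2 dvd_rfl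
  rw [d1, d2] at h1
  rw [d0, d2] at h2
  have h1' := h1
  have h2' := h2
  obtain ⟨w, hw⟩ := hpr (v 2)
  obtain ⟨w₀, hw₀⟩ := hpr (v 0)
  obtain ⟨w₁, hw₁⟩ := hpr (v 1)
  rw [← hw, ← hw₁, ← map_mul, ← map_mul, eq_comm, ← sub_eq_zero, ← map_sub, hker] at h1
  rw [← hw, ← hw₀, ← map_mul, ← map_mul, ← sub_eq_zero, ← map_sub, hker] at h2
  obtain ⟨t₁, ht₁⟩ := h1
  obtain ⟨t₀, ht₀⟩ := h2
  -- Because `F` lies in `(zⁿ, xy)`, the two equations put `x w` and `y w` into this ideal, hence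
  -- `w` itself.
  obtain ⟨e₀, e₁, he⟩ := exists_eq_of_X_mul_eq n w (w₁ * C (-(n + 1) : k) - X 2 * t₁) t₁
    (w₀ * C (-(n + 1) : k) - X 2 * t₀) t₀
    (by rw [surfaceEquation] at ht₁; linear_combination ht₁)
    (by rw [surfaceEquation] at ht₀; linear_combination ht₀)
  -- On the surface `xy = zⁿ⁺¹`, so `w = zⁿ (e₀ + z e₁)`; dividing by `∂F/∂z = -(n + 1) zⁿ` gives
  -- the multiplier. The other two components follow by cancelling `zⁿ`.
  obtain ⟨y, hy⟩ : ∃ y, y = pr (C (-(n + 1) : k)⁻¹ * (e₀ + X 2 * e₁)) := ⟨_, rfl⟩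
  have hv2 : v 2 = y * pr (C (-(n + 1) : k) * X 2 ^ n) := by
    rw [hy, ← hw, he, map_add, map_mul, map_mul _ (X 0 * X 1), hxy]
    simp only [map_mul pr, map_add pr, map_one] at hc' ⊢
    linear_combination -(pr (X 2 ^ n) * (pr e₀ + pr (X 2) * pr e₁)) * hc'
  rw [hv2, map_mul] at h1' h2'
  rw [map_mul, map_one] at hc'
  refine ⟨y, fun i => ?_⟩
  fin_cases i
  · refine sub_eq_zero.1 (hz _ ?_)
    simp only [Fin.zero_eta, d0]
    linear_combination -(v 0 - y * pr (X 1)) * pr (X 2 ^ n) * hc' -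
      pr (C (-(n + 1) : k)⁻¹) * h2'
  · refine sub_eq_zero.1 (hz _ ?_)
    simp only [Fin.mk_one, d1]
    linear_combination -(v 1 - y * pr (X 0)) * pr (X 2 ^ n) * hc' +
      pr (C (-(n + 1) : k)⁻¹) * h1'
  · rw [← d2] at hv2
    exact hv2

end GorensteinSurface

theorem proposition5p4 (k : Type*) [Field k] [CharZero k] (n : ℕ)
    (α β : Hochschild.HH k (GorensteinSurfaceRing k n) 2) :
    Hochschild.gerstenhaberProduct k (GorensteinSurfaceRing k n) α β = 0 := by
  have hself (α) : Hochschild.gerstenhaberProduct k (GorensteinSurfaceRing k n) α α = 0 := by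
    obtain ⟨f, rfl⟩ := Hochschild.toHH_surjective 2 α
    let pr : MvPolynomial (Fin 3) k →ₐ[k] GorensteinSurfaceRing k n := Ideal.Quotient.mkₐ k _
    have hker (r) : pr r = 0 ↔ surfaceEquation k n ∣ r :=
      Ideal.Quotient.eq_zero_iff_mem.trans Ideal.mem_span_singleton
    have hpr : Function.Surjective pr := Ideal.Quotient.mkₐ_surjective k _
    obtain ⟨f', hf', hb⟩ := exists_bracketTwo_self_mem_coboundaries_of_hypersurface pr hpr
      (surfaceEquation k n) (fun h => by
        have := congrArg (eval ![1, 1, 0]) h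
        simp [surfaceEquation] at this) hker (surface_koszul n pr hpr hker) f
    rw [hf', Hochschild.gerstenhaberProduct_toHH]
    exact (Hochschild.toHH_eq_zero_iff _).2 hb
  have hcomm : Hochschild.gerstenhaberProduct k (GorensteinSurfaceRing k n) α β =
      Hochschild.gerstenhaberProduct k (GorensteinSurfaceRing k n) β α := by
    obtain ⟨f, rfl⟩ := Hochschild.toHH_surjective 2 α
    obtain ⟨g, rfl⟩ := Hochschild.toHH_surjective 2 β
    simp only [Hochschild.gerstenhaberProduct_toHH, Hochschild.bracket_comm f.1 g.1]
  -- Polarization: the square of `α + β` is twice the product of `α` and `β`.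
  have h := hself (α + β)
  simp only [map_add, LinearMap.add_apply, hself, zero_add, add_zero, ← hcomm, ← two_smul k] at h
  exact (smul_eq_zero.1 h).resolve_left two_ne_zero
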